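/- Let $n\ge 2$, let $x_0\in\{0,1\}^n$, $0<p\le 1$ and $\theta\in\mathbb R$ (in particular $\theta\in[0,\pi/2]$), and let $$|\Psi(\theta)\rangle=\cos\theta\,|x_0\rangle+\frac{\sin\theta}{\sqrt{2^n-1}}\sum_{x\neq x_0}|x\rangle,\qquad \rho(\theta)=p\,|\Psi(\theta)\rangle\langle\Psi(\theta)|+(1-p)\frac{\mathbb 1}{2^n}$$ be the state of the depolarised Grover search on $n$ qubits. Fix a bipartition of the qubits into two non-empty sets $A,B$. Then $|\Psi(\theta)\rangle$ has a Schmidt decomposition $\cos\phi\,|u_0\rangle|v_0\rangle+\sin\phi\,|u_1\rangle|v_1\rangle$ with $\phi\in[0,\pi/2]$, where $u_0,u_1$ and $v_0,v_1$ are orthonormal pairs in $A$ and $B$. For every such decomposition put $d=p\sin 2\phi$ and $$\sigma=p\left(\cos^2\phi\,|u_0v_0\rangle\langle u_0v_0|+\sin^2\phi\,|u_1v_1\rangle\langle u_1v_1|\right)+(1-p)\frac{\mathbb 1}{2^n}.$$ Let $D$ be the quantum discord in bits, $$D(\rho)=S(\rho_B)-S(\rho_{AB})+\inf_{\Pi}\sum_k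 p_k\,S(\rho_{A|k}),$$ the infimum being over complete von Neumann measurements $\Pi$ of $B$ (orthonormal bases of $B$), where $p_k$ and $\rho_{A|k}$ are the outcome probabilities and the conditional states of $A$. Then $\rho(\theta)$ and $\sigma$ are density matrices, $\sigma$ is diagonal in a product orthonormal basis, $D(\sigma)=0$, $\operatorname{Tr}|\rho(\theta)-\sigma|=d$, and $$0\le D(\rho(\theta))\le 8d(n-1)+4h(d),\qquad h(x)=-x\log_2x-(1-x)\log_2(1-x).$$ Moreover, for all $\epsilon>0$ and $K>0$ there is a constant $C$, depending only on $\epsilon$ and $K$, such that whenever $0<p\le\min\left(1,K2^{-n(\frac12-\epsilon)}\right)$, the bound $8d(n-1)+4h(d)$ with $d=p\sin 2\phi$ is at most $C\,n\,2^{-n(\frac12-\epsilon)}$ for every $\phi\in[0,\pi/2]$, and $|D(\rho(\theta))|\le C\,n\,2^{-n(\frac12-\epsilon)}$ for all $x_0$, all $\theta$ and all bipartitions simultaneously. In particular, if $0<\epsilon<\frac12$, then for such $p$ the discord $D(\rho(\theta))$ tends to $0$ as $n\to\infty$, uniformly in $x_0$, $\theta$ and the bipartition. -/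

import Mathlib

open scoped Kronecker ComplexOrder

namespace GroverDiscord

/-! ### Finite-dimensional quantum states -/

section General

variable {ι a b : Type*} [Fintype ι] [DecidableEq ι]
  [Fintype a] [DecidableEq a] [Fintype b] [DecidableEq b]

/-- A density matrix: positive semidefinite with unit trace. -/
def IsDensity (M : Matrix ι ι ℂ) : Prop :=
  M.PosSemidef ∧ M.trace = 1

/-- The projector `|v⟩⟨v|`. -/
def proj (v : ι → ℂ) : Matrix ι ι ℂ :=
  Matrix.vecMulVec v (star v)

/-- Von Neumann entropy in bits, `-Tr (M log₂ M)`, of a Hermitian matrix, through its eigenvalues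
(with the convention `0 log 0 = 0`). -/
noncomputable def entropy (M : Matrix ι ι ℂ) : ℝ :=
  open scoped Classical in
  if h : M.IsHermitian then ∑ i, Real.negMulLog (h.eigenvalues i) / Real.log 2 else 0

/-- The trace norm `Tr |M|`, where `|M| = (M† M)^{1/2}`: the sum of the singular values. -/
noncomputable def traceNorm (M : Matrix ι ι ℂ) : ℝ :=
  ∑ i, √((Matrix.isHermitian_conjTranspose_mul_self M).eigenvalues i)

/-- Reduced state of the second system: partial trace over the first. -/
def traceLeft (ρ : Matrix (a × b) (a × b) ℂ) : Matrix b b ℂ :=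
  Matrix.of fun j j' => ∑ i, ρ (i, j) (i, j')

/-- The unnormalised state `Tr_B [(1 ⊗ |v⟩⟨v|) ρ]` of the first system after the outcome `|v⟩⟨v|`
of a measurement of the second system. -/
def postState (ρ : Matrix (a × b) (a × b) ℂ) (v : EuclideanSpace ℂ b) : Matrix a a ℂ :=
  Matrix.of fun i i' => ∑ j, ∑ j', star (v j) * ρ (i, j) (i', j') * v j'

/-- The probability of the outcome `|v⟩⟨v|`. -/
noncomputable def outcomeProb (ρ : Matrix (a × b) (a × b) ℂ) (v : EuclideanSpace ℂ b) : ℝ :=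
  (postState ρ v).trace.re

/-- The conditional entropy `∑ₖ pₖ S(ρ_{A|k})` of the first system given a complete von Neumann
measurement of the second system in the orthonormal basis `f`. Outcomes of probability zero
contribute zero. -/
noncomputable def measuredCondEntropy (ρ : Matrix (a × b) (a × b) ℂ)
    (f : OrthonormalBasis b ℂ (EuclideanSpace ℂ b)) : ℝ :=
  ∑ k, outcomeProb ρ (f k) *
    entropy ((((outcomeProb ρ (f k))⁻¹ : ℝ) : ℂ) • postState ρ (f k))

/-- Quantum discord (Ollivier--Zurek), in bits, with measurements on the second system:
`D(ρ) = S(ρ_B) - S(ρ_AB) + min_{Π} S(A | Π^B)`, over complete sets of one-dimensional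
orthogonal projectors. -/
noncomputable def discord (ρ : Matrix (a × b) (a × b) ℂ) : ℝ :=
  entropy (traceLeft ρ) - entropy ρ +
    ⨅ f : OrthonormalBasis b ℂ (EuclideanSpace ℂ b), measuredCondEntropy ρ f

/-- `σ` is diagonal in a product basis `e ⊗ f`, with `e`, `f` orthonormal bases of the two
systems. -/
def IsProductDiagonal (σ : Matrix (a × b) (a × b) ℂ) : Prop :=
  ∃ (e : OrthonormalBasis a ℂ (EuclideanSpace ℂ a))
    (f : OrthonormalBasis b ℂ (EuclideanSpace ℂ b)) (c : a → b → ℝ),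
    σ = ∑ k, ∑ l, (c k l : ℂ) • (proj (fun i => e k i) ⊗ₖ proj (fun j => f l j))

/-- `Ψ = cos φ |u₀⟩|v₀⟩ + sin φ |u₁⟩|v₁⟩` with `0 ≤ φ ≤ π/2` is a Schmidt decomposition of `Ψ`,
so that the (squared) Schmidt coefficients are `cos² φ` and `sin² φ`. -/
structure IsSchmidt (Ψ : a × b → ℂ) (φ : ℝ) (u : Fin 2 → EuclideanSpace ℂ a)
    (v : Fin 2 → EuclideanSpace ℂ b) : Prop where
  angle_mem : φ ∈ Set.Icc 0 (Real.pi / 2)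
  orthonormal_left : Orthonormal ℂ u
  orthonormal_right : Orthonormal ℂ v
  decomp : ∀ i j, Ψ (i, j) =
    (Real.cos φ : ℂ) * (u 0 i * v 0 j) + (Real.sin φ : ℂ) * (u 1 i * v 1 j)

end General

/-- Binary entropy in bits. -/
noncomputable def h (x : ℝ) : ℝ :=
  -x * Real.logb 2 x - (1 - x) * Real.logb 2 (1 - x)

/-! ### The depolarised Grover search on `n` qubits -/

/-- `|Ψ(θ)⟩ = cos θ |x₀⟩ + sin θ |ψ^⊥⟩`, where `|ψ^⊥⟩` is the uniform superposition of all
computational basis states other than the target `x₀`. -/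
noncomputable def groverVec {n : ℕ} (x₀ : Fin n → Bool) (θ : ℝ) : (Fin n → Bool) → ℂ :=
  fun x => if x = x₀ then (Real.cos θ : ℂ) else ((Real.sin θ / √(2 ^ n - 1) : ℝ) : ℂ)

/-- `ρ(θ) = p |Ψ(θ)⟩⟨Ψ(θ)| + (1 - p) 1 / 2ⁿ`. -/
noncomputable def groverState {n : ℕ} (x₀ : Fin n → Bool) (p θ : ℝ) :
    Matrix (Fin n → Bool) (Fin n → Bool) ℂ :=
  (p : ℂ) • proj (groverVec x₀ θ) + (((1 - p) / 2 ^ n : ℝ) : ℂ) • 1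

/-- Computational basis states of the qubits in `S`. -/
abbrev Inside {n : ℕ} (S : Finset (Fin n)) : Type := {i : Fin n // i ∈ S} → Bool

/-- Computational basis states of the qubits not in `S`. -/
abbrev Outside {n : ℕ} (S : Finset (Fin n)) : Type := {i : Fin n // ¬ i ∈ S} → Bool

/-- The bipartition of the register into the qubits in `S` and the qubits not in `S`. -/
def bipartition {n : ℕ} (S : Finset (Fin n)) : (Fin n → Bool) ≃ Inside S × Outside S :=
  Equiv.piEquivPiSubtypeProd (fun i => i ∈ S) (fun _ => Bool)

/-- `|Ψ(θ)⟩` across the bipartition `S`. -/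
noncomputable def groverVecAcross {n : ℕ} (S : Finset (Fin n)) (x₀ : Fin n → Bool) (θ : ℝ) :
    Inside S × Outside S → ℂ :=
  fun z => groverVec x₀ θ ((bipartition S).symm z)

/-- `ρ(θ)` across the bipartition `S`. -/
noncomputable def groverStateAcross {n : ℕ} (S : Finset (Fin n)) (x₀ : Fin n → Bool) (p θ : ℝ) :
    Matrix (Inside S × Outside S) (Inside S × Outside S) ℂ :=
  Matrix.reindex (bipartition S) (bipartition S) (groverState x₀ p θ)

/-- The comparison state: `ρ(θ)` without its off-diagonal terms in the Schmidt basis,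
`σ = p (cos² φ |u₀v₀⟩⟨u₀v₀| + sin² φ |u₁v₁⟩⟨u₁v₁|) + (1 - p) 1 / 2ⁿ`. -/
noncomputable def sigmaState {n : ℕ} (S : Finset (Fin n)) (p φ : ℝ)
    (u : Fin 2 → EuclideanSpace ℂ (Inside S)) (v : Fin 2 → EuclideanSpace ℂ (Outside S)) :
    Matrix (Inside S × Outside S) (Inside S × Outside S) ℂ :=
  (p : ℂ) • (((Real.cos φ ^ 2 : ℝ) : ℂ) • proj (fun z => u 0 z.1 * v 0 z.2) +
      ((Real.sin φ ^ 2 : ℝ) : ℂ) • proj (fun z => u 1 z.1 * v 1 z.2)) +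
    (((1 - p) / 2 ^ n : ℝ) : ℂ) • 1

end GroverDiscord

namespace GroverDiscord

set_option linter.unusedSectionVars false

/-! The discord is computed exactly, so no continuity estimate for entropies is needed. Across a
cut, the Grover vector lies in the span of the marked basis state and the uniform superposition of
the others on each side. Its coefficients form a real `2 × 2` matrix, whose singular value
decomposition is a Schmidt decomposition (`exists_isSchmidt`).

For `p |Ψ⟩⟨Ψ| + ε 1` of Schmidt rank at most two, measuring `g` on the second system leaves a
perturbed rank-one operator. Its spectrum can be indexed so that it is the average, with weights
`|⟨g, v j⟩|²`, of the spectra obtained in a basis `v` extending the Schmidt vectors. These weights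
are doubly stochastic and unnormalised Shannon entropy is concave, so measuring in `v` is optimal
(`iInf_measuredCondEntropy`). The marginal entropies cancel. With `η = -x log x`, in nats, the
discord is `η(p cos² φ + ε) + η(p sin² φ + ε) - η(p + ε) - η(ε)` (`IsSchmidt.discord_eq`).

Concavity of `η` makes this nonnegative, and elementary logarithm estimates bound it by `2d`
(`negMulLog_exchange_le_mul`), which is well below `8d(n-1) + 4h(d)`. The same optimality argument
gives zero discord for the dephased state. The scaling follows from a tangent-line bound on `h` at
`t = 2^{-n(1/2-ε)}`, where `ε` now denotes the scaling exponent (`discord_bound_le`). -/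

theorem proj_smul {ι : Type*} (c : ℂ) (w : ι → ℂ) : proj (c • w) = (c * star c) • proj w := by
  ext i j
  simp [proj, Matrix.vecMulVec_apply]
  ring

theorem isHermitian_sum_smul_proj {ι : Type*} [Fintype ι] (w : ι → ι → ℂ) (μ : ι → ℝ) :
    (∑ k, (μ k : ℂ) • proj (w k)).IsHermitian := by
  ext i j
  simp only [Matrix.conjTranspose_apply, Matrix.sum_apply, Matrix.smul_apply, proj,
    Matrix.vecMulVec_apply, Pi.star_apply, smul_eq_mul, star_sum, star_mul', star_star]
  exact Finset.sum_congr rfl fun k _ => by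
    rw [← starRingEnd_apply (μ k : ℂ), Complex.conj_ofReal, mul_comm (w k i)]

/-! ### Entropy and trace norm read off from an explicit spectral form -/

section Spectral

variable {ι κ : Type*} [Fintype ι] [DecidableEq ι] [Fintype κ] [DecidableEq κ]

/-- The vectors `w k` are orthonormal, in coordinates. -/
def IsOrthoFamily (w : ι → ι → ℂ) : Prop :=
  ∀ k l, star (w k) ⬝ᵥ w l = if k = l then 1 else 0

theorem isOrthoFamily_basis (e : OrthonormalBasis ι ℂ (EuclideanSpace ℂ ι)) :
    IsOrthoFamily fun k i => e k i := by
  intro k l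
  have := orthonormal_iff_ite.mp e.orthonormal k l
  rw [PiLp.inner_apply] at this
  simpa [dotProduct, mul_comm] using this

theorem IsOrthoFamily.tensor {w : ι → ι → ℂ} {x : κ → κ → ℂ} (hw : IsOrthoFamily w)
    (hx : IsOrthoFamily x) :
    IsOrthoFamily fun (k : ι × κ) (z : ι × κ) => w k.1 z.1 * x k.2 z.2 := by
  rintro ⟨k, k'⟩ ⟨l, l'⟩
  have h1 := hw k l
  have h2 := hx k' l'
  simp only [dotProduct, Pi.star_apply] at h1 h2 ⊢
  have : ∑ z : ι × κ, star (w k z.1 * x k' z.2) * (w l z.1 * x l' z.2)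
      = (∑ i, star (w k i) * w l i) * ∑ j, star (x k' j) * x l' j := by
    rw [Finset.sum_mul_sum, ← Finset.univ_product_univ, Finset.sum_product]
    refine Finset.sum_congr rfl fun i _ => Finset.sum_congr rfl fun j _ => ?_
    simp only [star_mul']
    ring
  rw [this, h1, h2]
  by_cases a : k = l <;> by_cases b : k' = l' <;> simp [a, b]

theorem sum_smul_proj_eq (w : ι → ι → ℂ) (μ : ι → ℂ) :
    ∑ k, μ k • proj (w k) = Matrix.of (fun i k => w k i) * Matrix.diagonal μ *
      (Matrix.of fun i k => w k i).conjTranspose := by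
  ext i j
  simp only [Matrix.sum_apply, Matrix.smul_apply, proj, Matrix.vecMulVec_apply, Matrix.mul_apply,
    Matrix.of_apply, Matrix.conjTranspose_apply, Pi.star_apply, smul_eq_mul]
  refine Finset.sum_congr rfl fun k _ => ?_
  rw [Finset.sum_eq_single k (fun b _ hb => by simp [hb]) (by simp), Matrix.diagonal_apply_eq]
  ring

theorem IsOrthoFamily.conjTranspose_mul_self {w : ι → ι → ℂ} (hw : IsOrthoFamily w) :
    (Matrix.of fun i k => w k i).conjTranspose * Matrix.of (fun i k => w k i) = 1 := by
  ext k l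
  rw [Matrix.one_apply, ← hw k l]
  simp [Matrix.mul_apply, dotProduct]

/-- There are as many vectors as coordinates, so the matrix of columns is square and its left
inverse is also a right inverse. -/
theorem IsOrthoFamily.sum_proj {w : ι → ι → ℂ} (hw : IsOrthoFamily w) :
    ∑ k, proj (w k) = 1 := by
  have h := sum_smul_proj_eq w 1
  simp only [Pi.one_apply, one_smul] at h
  rw [h, show Matrix.diagonal (1 : ι → ℂ) = 1 from Matrix.diagonal_one, Matrix.mul_one]
  exact mul_eq_one_comm.mp hw.conjTranspose_mul_self

/-- Conjugating by a unitary preserves the characteristic polynomial, whose roots are the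
eigenvalues. Equality holds only as multisets, since `eigenvalues` fixes its own ordering; this
suffices for symmetric sums. -/
theorem IsOrthoFamily.eigenvalues_eq {w : ι → ι → ℂ} (hw : IsOrthoFamily w) {μ : ι → ℝ}
    {M : Matrix ι ι ℂ} (hM : M.IsHermitian) (h : M = ∑ k, (μ k : ℂ) • proj (w k)) :
    Finset.univ.val.map hM.eigenvalues = Finset.univ.val.map μ := by
  have h1 : M.charpoly = (Matrix.diagonal fun k => (μ k : ℂ)).charpoly := by
    rw [h, sum_smul_proj_eq, Matrix.charpoly_mul_comm, ← Matrix.mul_assoc,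
      hw.conjTranspose_mul_self, Matrix.one_mul]
  have h2 := hM.roots_charpoly_eq_eigenvalues
  have h3 : (Matrix.diagonal fun k => (μ k : ℂ)).charpoly.roots =
      Finset.univ.val.map fun k => (μ k : ℂ) := by
    rw [Matrix.charpoly_diagonal, Finset.prod_eq_multiset_prod]
    simpa [Multiset.map_map] using
      Polynomial.roots_multiset_prod_X_sub_C (Finset.univ.val.map fun k => (μ k : ℂ))
  rw [h1, h3] at h2
  have h4 := congrArg (Multiset.map Complex.re) h2
  simpa [Multiset.map_map, Function.comp_def] using h4.symm

theorem IsOrthoFamily.sum_eigenvalues {w : ι → ι → ℂ} (hw : IsOrthoFamily w) {μ : ι → ℝ}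
    {M : Matrix ι ι ℂ} (hM : M.IsHermitian) (h : M = ∑ k, (μ k : ℂ) • proj (w k)) (g : ℝ → ℝ) :
    ∑ i, g (hM.eigenvalues i) = ∑ i, g (μ i) := by
  have := congrArg (fun s => (s.map g).sum) (hw.eigenvalues_eq hM h)
  simpa [Multiset.map_map] using this

/-- The entropy of a matrix given in spectral form. -/
theorem IsOrthoFamily.entropy_eq {w : ι → ι → ℂ} (hw : IsOrthoFamily w) {μ : ι → ℝ}
    {M : Matrix ι ι ℂ} (h : M = ∑ k, (μ k : ℂ) • proj (w k)) :
    entropy M = (∑ i, Real.negMulLog (μ i)) / Real.log 2 := by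
  have hM : M.IsHermitian := h ▸ isHermitian_sum_smul_proj w μ
  rw [entropy, dif_pos hM, ← Finset.sum_div, hw.sum_eigenvalues hM h Real.negMulLog]

theorem IsOrthoFamily.traceNorm_eq {w : ι → ι → ℂ} (hw : IsOrthoFamily w) {μ : ι → ℝ}
    {M : Matrix ι ι ℂ} (h : M.conjTranspose * M = ∑ k, (μ k : ℂ) • proj (w k)) :
    traceNorm M = ∑ i, √(μ i) := by
  rw [traceNorm, hw.sum_eigenvalues _ h Real.sqrt]

theorem IsOrthoFamily.trace_proj {w : ι → ι → ℂ} (hw : IsOrthoFamily w) (k : ι) :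
    (proj (w k)).trace = 1 := by
  rw [proj, Matrix.trace_vecMulVec, dotProduct_comm, hw k k, if_pos rfl]

/-- An orthonormal tuple is part of an orthonormal basis indexed by the coordinates. -/
theorem exists_basis_extension {m : ℕ} {u : Fin m → EuclideanSpace ℂ ι} (hu : Orthonormal ℂ u) :
    ∃ (e : OrthonormalBasis ι ℂ (EuclideanSpace ℂ ι)) (s : Fin m → ι),
      Function.Injective s ∧ ∀ j, e (s j) = u j := by
  have hc : Fintype.card (Fin m) ≤ Fintype.card ι := by
    simpa using hu.linearIndependent.fintype_card_le_finrank
  obtain ⟨s⟩ := Function.Embedding.nonempty_of_card_le hc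
  -- Outside the range of `s` the extended family takes the irrelevant default value `0`;
  -- orthonormality is only required on the range.
  have key : ∀ j, Function.extend s u 0 (s j) = u j := fun j => s.injective.extend_apply u 0 j
  have hv : Orthonormal ℂ ((Set.range s).domRestrict (Function.extend s u 0)) := by
    rw [orthonormal_iff_ite] at hu ⊢
    rintro ⟨_, j, rfl⟩ ⟨_, l, rfl⟩
    simp only [Set.domRestrict, key, hu]
    by_cases hjl : j = l
    · subst hjl
      simp
    · rw [if_neg hjl, if_neg fun h => hjl (s.injective (congrArg Subtype.val h))]
  obtain ⟨e, he⟩ := hv.exists_orthonormalBasis_extension_of_card_eq (by simp)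
  exact ⟨e, s, s.injective, fun j => (he _ ⟨j, rfl⟩).trans (key j)⟩

/-- Every vector is a multiple of a member of some orthonormal basis, at a prescribed index. -/
theorem exists_basis_smul (w : EuclideanSpace ℂ ι) (i : ι) :
    ∃ e : OrthonormalBasis ι ℂ (EuclideanSpace ℂ ι), w = (‖w‖ : ℂ) • e i := by
  by_cases h0 : w = 0
  · exact ⟨EuclideanSpace.basisFun ι ℂ, by simp [h0]⟩
  have hn : ‖w‖ ≠ 0 := norm_ne_zero_iff.mpr h0
  have hv : Orthonormal ℂ (({i} : Set ι).domRestrict fun _ => (‖w‖⁻¹ : ℂ) • w) := by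
    rw [orthonormal_iff_ite]
    rintro ⟨_, rfl⟩ ⟨_, rfl⟩
    have hn' : (‖w‖ : ℂ) ≠ 0 := by exact_mod_cast hn
    have : inner ℂ w w = (‖w‖ : ℂ) ^ 2 := inner_self_eq_norm_sq_to_K w
    rw [if_pos rfl, Set.domRestrict_apply, inner_smul_left, inner_smul_right, this, map_inv₀,
      Complex.conj_ofReal]
    field_simp
  obtain ⟨e, he⟩ := hv.exists_orthonormalBasis_extension_of_card_eq (by simp)
  refine ⟨e, ?_⟩
  rw [he i rfl, smul_smul, mul_inv_cancel₀ (by exact_mod_cast hn), one_smul]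

/-- The spectral form of a perturbed projector. -/
theorem exists_spectral_proj_add (w : ι → ℂ) (i : ι) (p ε : ℝ) :
    ∃ e : OrthonormalBasis ι ℂ (EuclideanSpace ℂ ι),
      (p : ℂ) • proj w + (ε : ℂ) • (1 : Matrix ι ι ℂ) =
        ∑ k, ((p * (if k = i then ∑ l, ‖w l‖ ^ 2 else 0) + ε : ℝ) : ℂ) • proj fun l => e k l := by
  obtain ⟨e, he⟩ := exists_basis_smul (WithLp.toLp 2 w) i
  refine ⟨e, ?_⟩
  have hw : w = (‖WithLp.toLp 2 w‖ : ℂ) • fun l => e i l := by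
    ext l
    exact congrArg (fun v : EuclideanSpace ℂ ι => v l) he
  have hs : ∑ l, ‖w l‖ ^ 2 = ‖WithLp.toLp 2 w‖ ^ 2 := by rw [EuclideanSpace.norm_sq_eq]
  have hp : proj w = ((∑ l, ‖w l‖ ^ 2 : ℝ) : ℂ) • proj fun l => e i l := by
    rw [hs]
    conv_lhs => rw [hw, proj_smul]
    congr 1
    simp [sq]
  rw [hp, ← (isOrthoFamily_basis e).sum_proj, Finset.smul_sum]
  push_cast
  simp only [add_smul, Finset.sum_add_distrib]
  congr 1
  exact ((Finset.sum_eq_single i (fun k _ hk => by simp [hk]) (by simp)).trans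
    (by simp [smul_smul])).symm

end Spectral

/-! ### Concavity of unnormalised Shannon entropy -/

section Shannon

variable {a b : Type*} [Fintype a] [Fintype b]

/-- Unnormalised Shannon entropy `-∑ yᵢ log (yᵢ / ∑ yᵢ)`, in nats. -/
noncomputable def massEntropy (y : a → ℝ) : ℝ :=
  ∑ i, Real.negMulLog (y i) - Real.negMulLog (∑ i, y i)

theorem massEntropy_eq (y : a → ℝ) :
    massEntropy y = ∑ i, y i * (Real.log (∑ l, y l) - Real.log (y i)) := by
  simp only [massEntropy, Real.negMulLog, mul_sub, Finset.sum_sub_distrib, ← Finset.sum_mul]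
  simp only [neg_mul, Finset.sum_neg_distrib]
  ring

/-- Gibbs' inequality for finite measures. -/
theorem massEntropy_le {y z : a → ℝ} (hy : ∀ i, 0 ≤ y i) (hz : ∀ i, 0 ≤ z i)
    (hyz : ∀ i, z i = 0 → y i = 0) :
    massEntropy y ≤ ∑ i, y i * (Real.log (∑ l, z l) - Real.log (z i)) := by
  rw [massEntropy_eq]
  have hY : 0 ≤ ∑ l, y l := Finset.sum_nonneg fun i _ => hy i
  -- This is `log x ≤ x - 1` at `x = zᵢ Y / (Z yᵢ)`, where `Y` and `Z` are the total masses. The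
  -- correction terms sum to at most zero.
  have key : ∀ i, y i * (Real.log (∑ l, y l) - Real.log (y i)) ≤
      y i * (Real.log (∑ l, z l) - Real.log (z i)) +
        (z i * ((∑ l, y l) / ∑ l, z l) - y i) := by
    intro i
    rcases (hy i).eq_or_lt with h0 | hpos
    · rw [← h0]
      simp only [zero_mul, zero_add, sub_zero]
      exact mul_nonneg (hz i) (div_nonneg hY (Finset.sum_nonneg fun i _ => hz i))
    have hzi : 0 < z i := (hz i).lt_of_ne fun h => hpos.ne' (hyz i h.symm)
    have hY' : 0 < ∑ l, y l :=
      hpos.trans_le (Finset.single_le_sum (fun i _ => hy i) (Finset.mem_univ i))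
    have hZ' : 0 < ∑ l, z l :=
      hzi.trans_le (Finset.single_le_sum (fun i _ => hz i) (Finset.mem_univ i))
    have hl := Real.log_le_sub_one_of_pos
      (show 0 < z i * (∑ l, y l) / ((∑ l, z l) * y i) by positivity)
    rw [Real.log_div (by positivity) (by positivity), Real.log_mul hzi.ne' hY'.ne',
      Real.log_mul hZ'.ne' hpos.ne'] at hl
    have h2 := mul_le_mul_of_nonneg_left hl hpos.le
    have h3 : y i * (z i * (∑ l, y l) / ((∑ l, z l) * y i) - 1) =
        z i * ((∑ l, y l) / ∑ l, z l) - y i := by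
      field_simp
    rw [h3] at h2
    linarith
  have hsum := Finset.sum_le_sum fun i (_ : i ∈ Finset.univ) => key i
  rw [Finset.sum_add_distrib, Finset.sum_sub_distrib, ← Finset.sum_mul] at hsum
  -- Only an inequality is stated: if the total mass of `z` vanishes, the quotient is `0` by
  -- convention.
  have hle : (∑ l, z l) * ((∑ l, y l) / ∑ l, z l) ≤ ∑ l, y l := by
    by_cases h : ∑ l, z l = 0
    · simpa [h] using hY
    · rw [mul_div_cancel₀ _ h]
  linarith

/-- The unnormalised Shannon entropy is concave. -/
theorem sum_mul_massEntropy_le (P : b → ℝ) (Y : b → a → ℝ) (hP : ∀ j, 0 ≤ P j)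
    (hY : ∀ j i, 0 ≤ Y j i) :
    ∑ j, P j * massEntropy (Y j) ≤ massEntropy fun i => ∑ j, P j * Y j i := by
  set z : a → ℝ := fun i => ∑ j, P j * Y j i with hz
  have hz0 : ∀ i, 0 ≤ z i := fun i => Finset.sum_nonneg fun j _ => mul_nonneg (hP j) (hY j i)
  -- The entropy of the mixture is the average of the cross-entropies of its components relative to
  -- the mixture, so Gibbs' inequality applies to each component.
  have h1 : massEntropy z =
      ∑ j, P j * ∑ i, Y j i * (Real.log (∑ l, z l) - Real.log (z i)) := by
    rw [massEntropy_eq]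
    generalize Real.log (∑ l, z l) = Z
    simp only [Finset.mul_sum]
    refine Eq.trans ?_ Finset.sum_comm
    refine Finset.sum_congr rfl fun i _ => ?_
    rw [← Finset.sum_congr rfl fun j _ => mul_assoc (P j) (Y j i) (Z - Real.log (z i)),
      ← Finset.sum_mul]
  rw [h1]
  refine Finset.sum_le_sum fun j _ => ?_
  rcases (hP j).eq_or_lt with h0 | hpos
  · simp [← h0]
  refine mul_le_mul_of_nonneg_left (massEntropy_le (hY j) hz0 fun i hi => ?_) hpos.le
  have h2 := (Finset.sum_eq_zero_iff_of_nonneg fun j _ => mul_nonneg (hP j) (hY j i)).mp hi j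
    (Finset.mem_univ j)
  exact (mul_eq_zero.mp h2).resolve_left hpos.ne'

/-- Normalising a finite measure: mass times the entropy of the conditional distribution. -/
theorem mass_mul_sum_negMulLog {y : a → ℝ} (hy : ∀ i, 0 ≤ y i) :
    (∑ i, y i) * ∑ i, Real.negMulLog ((∑ l, y l)⁻¹ * y i) = massEntropy y := by
  by_cases h : ∑ l, y l = 0
  · have h0 := (Finset.sum_eq_zero_iff_of_nonneg fun i _ => hy i).mp h
    have h1 : ∀ i, y i = 0 := fun i => h0 i (Finset.mem_univ i)
    simp [massEntropy, h1]
  · simp only [Real.negMulLog_mul, Finset.sum_add_distrib, ← Finset.sum_mul, ← Finset.mul_sum,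
      massEntropy]
    simp only [Real.negMulLog, Real.log_inv]
    field_simp
    ring

end Shannon

/-! ### Scalar inequalities for `-x log x` and the binary entropy -/

section Scalar

/-- Both `x + ε` and `y + ε` are convex combinations of `x + y + ε` and `ε`, with weights
interchanged. Adding the two concavity inequalities gives the claim. -/
theorem negMulLog_exchange_nonneg {x y ε : ℝ} (hx : 0 ≤ x) (hy : 0 ≤ y) (hε : 0 ≤ ε) :
    0 ≤ Real.negMulLog (x + ε) + Real.negMulLog (y + ε) - Real.negMulLog (x + y + ε)
      - Real.negMulLog ε := by
  rcases (show 0 ≤ x + y by linarith).eq_or_lt with h | h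
  · obtain rfl : x = 0 := by linarith
    obtain rfl : y = 0 := by linarith
    simp
  have hc := Real.concaveOn_negMulLog
  have hT : x + y + ε ∈ Set.Ici (0 : ℝ) := Set.mem_Ici.mpr (by linarith)
  have hs : x / (x + y) + y / (x + y) = 1 := by rw [← add_div, div_self h.ne']
  have h1 := hc.2 hT (Set.mem_Ici.mpr hε) (div_nonneg hx h.le) (div_nonneg hy h.le) hs
  have h2 := hc.2 hT (Set.mem_Ici.mpr hε) (div_nonneg hy h.le) (div_nonneg hx h.le)
    (by rw [add_comm, hs])
  simp only [smul_eq_mul] at h1 h2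
  have e1 : x / (x + y) * (x + y + ε) + y / (x + y) * ε = x + ε := by field_simp; ring
  have e2 : y / (x + y) * (x + y + ε) + x / (x + y) * ε = y + ε := by field_simp; ring
  rw [e1] at h1
  rw [e2] at h2
  have e3 : y / (x + y) = 1 - x / (x + y) := by linarith
  rw [e3] at h1 h2
  linarith

/-- The left side splits into terms with prefactors `x`, `y` and `ε`. The first two log-ratios only
grow when `ε` is removed, and the last term is nonpositive because `(x + y + ε) ε ≤ (x + ε)(y + ε)`.
-/
theorem negMulLog_exchange_le {x y ε : ℝ} (hx : 0 < x) (hy : 0 < y) (hε : 0 ≤ ε) :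
    Real.negMulLog (x + ε) + Real.negMulLog (y + ε) - Real.negMulLog (x + y + ε)
      - Real.negMulLog ε ≤ x * Real.log ((x + y) / x) + y * Real.log ((x + y) / y) := by
  have h1 : Real.log (x + y + ε) - Real.log (x + ε) ≤ Real.log ((x + y) / x) := by
    rw [← Real.log_div (by positivity) (by positivity)]
    apply Real.log_le_log (by positivity)
    rw [div_le_div_iff₀ (by positivity) hx]
    nlinarith [mul_nonneg hy.le hε]
  have h2 : Real.log (x + y + ε) - Real.log (y + ε) ≤ Real.log ((x + y) / y) := by
    rw [← Real.log_div (by positivity) (by positivity)]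
    apply Real.log_le_log (by positivity)
    rw [div_le_div_iff₀ (by positivity) hy]
    nlinarith [mul_nonneg hx.le hε]
  have h3 : ε * (Real.log (x + y + ε) + Real.log ε - Real.log (x + ε) - Real.log (y + ε)) ≤ 0 := by
    rcases hε.eq_or_lt with h | h
    · simp [← h]
    apply mul_nonpos_of_nonneg_of_nonpos hε
    have : Real.log ((x + y + ε) * ε) ≤ Real.log ((x + ε) * (y + ε)) :=
      Real.log_le_log (by positivity) (by nlinarith [mul_pos hx hy])
    rw [Real.log_mul (by positivity) h.ne', Real.log_mul (by positivity) (by positivity)] at this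
    linarith
  have h4 := mul_le_mul_of_nonneg_left h1 hx.le
  have h5 := mul_le_mul_of_nonneg_left h2 hy.le
  simp only [Real.negMulLog]
  linarith

/-- The entropy of mixing is at most of the order of the geometric mean of the weights. -/
theorem negMulLog_exchange_le_mul {p ε φ : ℝ} (hp : 0 ≤ p) (hε : 0 ≤ ε)
    (hφ : φ ∈ Set.Icc 0 (Real.pi / 2)) :
    Real.negMulLog (p * Real.cos φ ^ 2 + ε) + Real.negMulLog (p * Real.sin φ ^ 2 + ε)
      - Real.negMulLog (p + ε) - Real.negMulLog ε ≤ 2 * (p * Real.sin (2 * φ)) := by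
  have hc : 0 ≤ Real.cos φ := Real.cos_nonneg_of_mem_Icc ⟨by linarith [hφ.1, Real.pi_pos], hφ.2⟩
  have hs : 0 ≤ Real.sin φ := Real.sin_nonneg_of_nonneg_of_le_pi hφ.1
    (by linarith [hφ.2, Real.pi_pos])
  have hcs := Real.cos_sq_add_sin_sq φ
  rw [Real.sin_two_mul]
  generalize Real.cos φ = c at *
  generalize Real.sin φ = s at *
  rcases hp.eq_or_lt with h | hp
  · simp [← h]
  -- When `cos φ` or `sin φ` vanishes both sides are zero; these cases are removed so that
  -- logarithms have positive arguments.
  rcases hc.eq_or_lt with h | hc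
  · rw [← h] at hcs ⊢
    have : s ^ 2 = 1 := by linarith
    simp [this]
  rcases hs.eq_or_lt with h | hs
  · rw [← h] at hcs ⊢
    have : c ^ 2 = 1 := by linarith
    simp [this]
  have hsum : p * c ^ 2 + p * s ^ 2 = p := by rw [← mul_add, hcs, mul_one]
  have h1 := negMulLog_exchange_le (x := p * c ^ 2) (y := p * s ^ 2) (by positivity)
    (by positivity) hε
  rw [hsum] at h1
  -- Here `r² log (1/r²) = 2 r² log (1/r) ≤ 2 r (1 - r)`, and `1 - r ≤ t` on the quarter circle.
  -- Applying it to both orders of `cos φ, sin φ` gives `4 p cos φ sin φ` in total.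
  have aux : ∀ r t : ℝ, 0 < r → 0 < t → r ^ 2 + t ^ 2 = 1 →
      p * r ^ 2 * Real.log (p / (p * r ^ 2)) ≤ 2 * (p * (r * t)) := by
    intro r t hr ht hrt
    have e : p / (p * r ^ 2) = (r⁻¹) ^ 2 := by field_simp
    have hl := Real.log_le_sub_one_of_pos (inv_pos.mpr hr)
    rw [e, Real.log_pow]
    have h2 := mul_le_mul_of_nonneg_left hl (show 0 ≤ 2 * (p * r ^ 2) by positivity)
    have h3 : 2 * (p * r ^ 2) * (r⁻¹ - 1) = 2 * (p * (r * (1 - r))) := by field_simp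
    have h4 : 1 - r ≤ t := by nlinarith
    have h5 : p * (r * (1 - r)) ≤ p * (r * t) := by gcongr
    push_cast
    linarith
  have h2 := aux c s hc hs hcs
  have h3 := aux s c hs hc (by linarith)
  have h4 : s * c = c * s := mul_comm s c
  rw [h4] at h3
  nlinarith

theorem h_eq_binEntropy (x : ℝ) : h x = Real.binEntropy x / Real.log 2 := by
  simp only [h, Real.logb, Real.binEntropy, Real.log_inv]
  ring

theorem h_nonneg {x : ℝ} (h0 : 0 ≤ x) (h1 : x ≤ 1) : 0 ≤ h x := by
  rw [h_eq_binEntropy]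
  exact div_nonneg (Real.binEntropy_nonneg h0 h1) (Real.log_nonneg (by norm_num))

/-- A tangent-line bound on the binary entropy. -/
theorem h_le {x t : ℝ} (h0 : 0 ≤ x) (h1 : x ≤ 1) (ht : 0 < t) :
    h x ≤ (t - x * Real.log t) / Real.log 2 := by
  rw [h_eq_binEntropy]
  have hl2 : 0 < Real.log 2 := Real.log_pos (by norm_num)
  apply div_le_div_of_nonneg_right _ hl2.le
  rw [Real.binEntropy_eq_negMulLog_add_negMulLog_one_sub]
  have e1 : Real.negMulLog x ≤ t - x - x * Real.log t := by
    rcases h0.eq_or_lt with h | h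
    · simp [← h, ht.le]
    have := Real.log_le_sub_one_of_pos (div_pos ht h)
    rw [Real.log_div ht.ne' h.ne'] at this
    have h2 := mul_le_mul_of_nonneg_left this h.le
    have h3 : x * (t / x - 1) = t - x := by field_simp
    rw [Real.negMulLog]
    linarith
  have e2 : Real.negMulLog (1 - x) ≤ x := by
    rcases h1.eq_or_lt with h | h
    · simp [h]
    have h' : 0 < 1 - x := by linarith
    have := Real.one_sub_inv_le_log_of_pos h'
    have h2 := mul_le_mul_of_nonneg_left this h'.le
    have h3 : (1 - x) * (1 - (1 - x)⁻¹) = -x := by field_simp; ring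
    rw [Real.negMulLog]
    linarith
  linarith

end Scalar

/-! ### Partial traces, post-measurement states and the optimal measurement -/

section Partial

variable {a b : Type*} [Fintype a] [DecidableEq a] [Fintype b] [DecidableEq b]

theorem sum_star_mul_eq_inner (g v : EuclideanSpace ℂ b) :
    ∑ j, star (g j) * v j = inner ℂ g v := by
  simp [PiLp.inner_apply, mul_comm]

theorem sum_mul_star_eq_inner (g v : EuclideanSpace ℂ b) :
    ∑ j, g j * star (v j) = inner ℂ v g := by
  simp [PiLp.inner_apply]

theorem postState_add (ρ τ : Matrix (a × b) (a × b) ℂ) (g : EuclideanSpace ℂ b) :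
    postState (ρ + τ) g = postState ρ g + postState τ g := by
  ext i i'
  simp [postState, mul_add, add_mul, Finset.sum_add_distrib]

theorem postState_smul (c : ℂ) (ρ : Matrix (a × b) (a × b) ℂ) (g : EuclideanSpace ℂ b) :
    postState (c • ρ) g = c • postState ρ g := by
  ext i i'
  simp only [postState, Matrix.of_apply, Matrix.smul_apply, smul_eq_mul, Finset.mul_sum]
  exact Finset.sum_congr rfl fun j _ => Finset.sum_congr rfl fun j' _ => by ring

theorem postState_proj (Ψ : a × b → ℂ) (g : EuclideanSpace ℂ b) :
    postState (proj Ψ) g = proj fun i => ∑ j, star (g j) * Ψ (i, j) := by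
  ext i i'
  simp only [postState, proj, Matrix.of_apply, Matrix.vecMulVec_apply, Pi.star_apply, star_sum,
    star_mul', star_star, Finset.sum_mul_sum]
  exact Finset.sum_congr rfl fun j _ => Finset.sum_congr rfl fun j' _ => by ring

theorem postState_proj_tensor (u : a → ℂ) (v g : EuclideanSpace ℂ b) :
    postState (proj fun z : a × b => u z.1 * v z.2) g =
      ((‖(inner ℂ g v : ℂ)‖ ^ 2 : ℝ) : ℂ) • proj u := by
  rw [postState_proj]
  have : (fun i => ∑ j, star (g j) * (u i * v j)) = (inner ℂ g v : ℂ) • u := by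
    ext i
    rw [Pi.smul_apply, smul_eq_mul, ← sum_star_mul_eq_inner, Finset.sum_mul]
    exact Finset.sum_congr rfl fun j _ => by ring
  rw [this, proj_smul]
  congr 1
  rw [← starRingEnd_apply, Complex.mul_conj, Complex.normSq_eq_norm_sq]

theorem postState_one {g : EuclideanSpace ℂ b} (hg : ‖g‖ = 1) :
    postState (1 : Matrix (a × b) (a × b) ℂ) g = 1 := by
  ext i i'
  have h1 : ∑ j, star (g j) * g j = 1 := by
    rw [sum_star_mul_eq_inner, inner_self_eq_norm_sq_to_K, hg]
    simp
  by_cases h : i = i' <;> simp_all [postState, Matrix.one_apply]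

theorem traceLeft_add (ρ τ : Matrix (a × b) (a × b) ℂ) :
    traceLeft (ρ + τ) = traceLeft ρ + traceLeft τ := by
  ext j j'
  simp [traceLeft, Finset.sum_add_distrib]

theorem traceLeft_smul (c : ℂ) (ρ : Matrix (a × b) (a × b) ℂ) :
    traceLeft (c • ρ) = c • traceLeft ρ := by
  ext j j'
  simp [traceLeft, Finset.mul_sum]

theorem traceLeft_one :
    traceLeft (1 : Matrix (a × b) (a × b) ℂ) = (Fintype.card a : ℂ) • 1 := by
  ext j j'
  by_cases h : j = j' <;> simp [traceLeft, Matrix.one_apply, h]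

theorem traceLeft_proj_tensor (u : EuclideanSpace ℂ a) (v : b → ℂ) (hu : ‖u‖ = 1) :
    traceLeft (proj fun z : a × b => u z.1 * v z.2) = proj v := by
  ext j j'
  have h1 : ∑ i, u i * star (u i) = 1 := by
    rw [sum_mul_star_eq_inner, inner_self_eq_norm_sq_to_K, hu]
    simp
  simp only [traceLeft, proj, Matrix.of_apply, Matrix.vecMulVec_apply, Pi.star_apply, star_mul']
  rw [← one_mul (v j * star (v j')), ← h1, Finset.sum_mul]
  exact Finset.sum_congr rfl fun i _ => by ring

/-- A measurement outcome contributes the unnormalised Shannon entropy of the spectrum. -/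
theorem outcomeProb_mul_entropy {ρ : Matrix (a × b) (a × b) ℂ} {g : EuclideanSpace ℂ b}
    {w : a → a → ℂ} (hw : IsOrthoFamily w) {y : a → ℝ} (hy : ∀ i, 0 ≤ y i)
    (h : postState ρ g = ∑ i, (y i : ℂ) • proj (w i)) :
    outcomeProb ρ g * entropy ((((outcomeProb ρ g)⁻¹ : ℝ) : ℂ) • postState ρ g) =
      massEntropy y / Real.log 2 := by
  have hp : outcomeProb ρ g = ∑ i, y i := by
    rw [outcomeProb, h, Matrix.trace_sum]
    simp [Matrix.trace_smul, hw.trace_proj]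
  rw [hp, hw.entropy_eq (μ := fun i => (∑ l, y l)⁻¹ * y i)
      (by
        rw [h, Finset.smul_sum]
        exact Finset.sum_congr rfl fun i _ => by rw [smul_smul, Complex.ofReal_mul]), ← mul_div_assoc, mass_mul_sum_negMulLog hy]

/-- If the post-measurement spectra are mixtures, with the doubly stochastic weights
`|⟨f k, v j⟩|²`, of spectra `Y j`, then measuring in the basis `v` is optimal. -/
theorem iInf_measuredCondEntropy {ρ : Matrix (a × b) (a × b) ℂ}
    (v : OrthonormalBasis b ℂ (EuclideanSpace ℂ b)) {Y : b → a → ℝ} (hY : ∀ j i, 0 ≤ Y j i)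
    (h : ∀ g : EuclideanSpace ℂ b, ‖g‖ = 1 → ∃ e : OrthonormalBasis a ℂ (EuclideanSpace ℂ a),
      postState ρ g = ∑ i, ((∑ j, ‖(inner ℂ g (v j) : ℂ)‖ ^ 2 * Y j i : ℝ) : ℂ) •
        proj fun l => e i l) :
    ⨅ f : OrthonormalBasis b ℂ (EuclideanSpace ℂ b), measuredCondEntropy ρ f =
      (∑ j, massEntropy (Y j)) / Real.log 2 := by
  have hl2 : 0 < Real.log 2 := Real.log_pos (by norm_num)
  have hf : ∀ f : OrthonormalBasis b ℂ (EuclideanSpace ℂ b), measuredCondEntropy ρ f =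
      (∑ k, massEntropy fun i => ∑ j, ‖(inner ℂ (f k) (v j) : ℂ)‖ ^ 2 * Y j i) / Real.log 2 := by
    intro f
    rw [measuredCondEntropy, Finset.sum_div]
    refine Finset.sum_congr rfl fun k _ => ?_
    obtain ⟨e, he⟩ := h (f k) (f.norm_eq_one k)
    exact outcomeProb_mul_entropy (isOrthoFamily_basis e)
      (fun i => Finset.sum_nonneg fun j _ => mul_nonneg (by positivity) (hY j i)) he
  have hlow : ∀ f : OrthonormalBasis b ℂ (EuclideanSpace ℂ b),
      (∑ j, massEntropy (Y j)) / Real.log 2 ≤ measuredCondEntropy ρ f := by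
    intro f
    rw [hf]
    apply div_le_div_of_nonneg_right _ hl2.le
    -- The weights sum to one over `k` because `f` is an orthonormal basis and `v j` a unit vector;
    -- concavity is then applied for each outcome `k`.
    calc ∑ j, massEntropy (Y j)
        = ∑ j, (∑ k, ‖(inner ℂ (f k) (v j) : ℂ)‖ ^ 2) * massEntropy (Y j) := by
          refine Finset.sum_congr rfl fun j _ => ?_
          rw [f.sum_sq_norm_inner_right, v.norm_eq_one]
          ring
      _ = ∑ k, ∑ j, ‖(inner ℂ (f k) (v j) : ℂ)‖ ^ 2 * massEntropy (Y j) := by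
          simp only [Finset.sum_mul]
          exact Finset.sum_comm
      _ ≤ _ := Finset.sum_le_sum fun k _ =>
          sum_mul_massEntropy_le _ Y (fun j => by positivity) hY
  -- Measuring in `v` itself makes the weights a Kronecker delta, so the lower bound is attained.
  have hatt : measuredCondEntropy ρ v = (∑ j, massEntropy (Y j)) / Real.log 2 := by
    rw [hf]
    congr 2
    ext k
    congr 1
    ext i
    rw [Finset.sum_eq_single k (fun j _ hj => ?_) (by simp)]
    · simp
    · simp [orthonormal_iff_ite.mp v.orthonormal, hj.symm]
  apply le_antisymm
  · rw [← hatt]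
    exact ciInf_le ⟨_, Set.forall_mem_range.mpr hlow⟩ v
  · have : Nonempty (OrthonormalBasis b ℂ (EuclideanSpace ℂ b)) := ⟨v⟩
    exact le_ciInf hlow

end Partial

/-! ### Discord and trace distance for noisy states of Schmidt rank at most two -/

section Schmidt

theorem star_ofReal (r : ℝ) : star (r : ℂ) = r := Complex.conj_ofReal r

variable {a b : Type*} [Fintype a] [DecidableEq a] [Fintype b] [DecidableEq b]

/-- The common spectral form for reduced, post-measurement and joint states. The levels `k` and `l`
may coincide, in which case the weights add. -/
theorem IsOrthoFamily.sum_two_level {w : a → a → ℂ} (hw : IsOrthoFamily w) (k l : a)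
    (p ε α β : ℝ) :
    ∑ x, ((p * ((if x = k then α else 0) + if x = l then β else 0) + ε : ℝ) : ℂ) • proj (w x) =
      (p : ℂ) • ((α : ℂ) • proj (w k) + (β : ℂ) • proj (w l)) + (ε : ℂ) • 1 := by
  rw [← hw.sum_proj]
  have h : ∀ (m : a) (r : ℝ), ∑ x, ((if x = m then r else 0 : ℝ) : ℂ) • proj (w x) =
      (r : ℂ) • proj (w m) := fun m r =>
    (Finset.sum_eq_single m (fun x _ hx => by simp [hx]) (by simp)).trans (by simp)
  rw [← h k α, ← h l β, ← Finset.sum_add_distrib, Finset.smul_sum, Finset.smul_sum,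
    ← Finset.sum_add_distrib]
  refine Finset.sum_congr rfl fun x _ => ?_
  rw [← add_smul, smul_smul, ← add_smul]
  push_cast
  rfl

/-- The mixture of the two product states `u l ⊗ v l`, with white noise added. -/
noncomputable def schmidtMix (p ε α β : ℝ) (u : Fin 2 → EuclideanSpace ℂ a)
    (v : Fin 2 → EuclideanSpace ℂ b) : Matrix (a × b) (a × b) ℂ :=
  (p : ℂ) • ((α : ℂ) • proj (fun z => u 0 z.1 * v 0 z.2) +
    (β : ℂ) • proj (fun z => u 1 z.1 * v 1 z.2)) + (ε : ℂ) • 1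

/-- The joint spectrum of `schmidtMix`. -/
def mixWeight (p ε α β : ℝ) (i : Fin 2 → a) (j : Fin 2 → b) (y : b) (x : a) : ℝ :=
  p * ((if (x, y) = (i 0, j 0) then α else 0) + if (x, y) = (i 1, j 1) then β else 0) + ε

/-- The spectra of the post-measurement states of a noisy entangled state in its Schmidt basis. -/
def pureWeight (p ε α β : ℝ) (i : Fin 2 → a) (j : Fin 2 → b) (y : b) (x : a) : ℝ :=
  p * (if x = i 0 then (if y = j 0 then α else 0) + (if y = j 1 then β else 0) else 0) + ε

theorem mixWeight_nonneg {p ε α β : ℝ} (hp : 0 ≤ p) (hε : 0 ≤ ε) (hα : 0 ≤ α) (hβ : 0 ≤ β)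
    (i : Fin 2 → a) (j : Fin 2 → b) (y : b) (x : a) : 0 ≤ mixWeight p ε α β i j y x := by
  unfold mixWeight
  have : (0 : ℝ) ≤ (if (x, y) = (i 0, j 0) then α else 0) +
      if (x, y) = (i 1, j 1) then β else 0 := by
    split_ifs <;> positivity
  positivity

theorem pureWeight_nonneg {p ε α β : ℝ} (hp : 0 ≤ p) (hε : 0 ≤ ε) (hα : 0 ≤ α) (hβ : 0 ≤ β)
    (i : Fin 2 → a) (j : Fin 2 → b) (y : b) (x : a) : 0 ≤ pureWeight p ε α β i j y x := by
  unfold pureWeight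
  have : (0 : ℝ) ≤ (if x = i 0 then (if y = j 0 then α else 0) + (if y = j 1 then β else 0)
      else 0) := by
    split_ifs <;> positivity
  positivity

theorem sum_mixWeight (p ε α β : ℝ) (i : Fin 2 → a) (j : Fin 2 → b) (y : b) :
    ∑ x, mixWeight p ε α β i j y x =
      p * ((if y = j 0 then α else 0) + if y = j 1 then β else 0) + Fintype.card a * ε := by
  simp [mixWeight, Finset.sum_add_distrib, ← Finset.mul_sum, ite_and]

theorem sum_pureWeight (p ε α β : ℝ) (i : Fin 2 → a) (j : Fin 2 → b) (y : b) :
    ∑ x, pureWeight p ε α β i j y x =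
      p * ((if y = j 0 then α else 0) + if y = j 1 then β else 0) + Fintype.card a * ε := by
  simp [pureWeight, Finset.sum_add_distrib]

theorem sum_mul_mixWeight {P : b → ℝ} (hP : ∑ y, P y = 1) (p ε α β : ℝ) (i : Fin 2 → a)
    (j : Fin 2 → b) (x : a) :
    ∑ y, P y * mixWeight p ε α β i j y x =
      p * ((if x = i 0 then P (j 0) * α else 0) + if x = i 1 then P (j 1) * β else 0) + ε := by
  have h : ∀ y, P y * mixWeight p ε α β i j y x =
      p * ((if y = j 0 then (if x = i 0 then P y * α else 0) else 0) +
        if y = j 1 then (if x = i 1 then P y * β else 0) else 0) + P y * ε := by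
    intro y
    unfold mixWeight
    simp only [Prod.mk.injEq, ite_and]
    split_ifs <;> ring
  simp only [h, Finset.sum_add_distrib, ← Finset.mul_sum, ← Finset.sum_mul, hP, Finset.sum_ite_eq',
    Finset.mem_univ, if_true, one_mul]

theorem sum_mul_pureWeight {P : b → ℝ} (hP : ∑ y, P y = 1) (p ε α β : ℝ) (i : Fin 2 → a)
    (j : Fin 2 → b) (x : a) :
    ∑ y, P y * pureWeight p ε α β i j y x =
      p * (if x = i 0 then P (j 0) * α + P (j 1) * β else 0) + ε := by
  have h : ∀ y, P y * pureWeight p ε α β i j y x =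
      p * ((if y = j 0 then (if x = i 0 then P y * α else 0) else 0) +
        if y = j 1 then (if x = i 0 then P y * β else 0) else 0) + P y * ε := by
    intro y
    unfold pureWeight
    split_ifs <;> ring
  simp only [h, Finset.sum_add_distrib, ← Finset.mul_sum, ← Finset.sum_mul, hP, Finset.sum_ite_eq',
    Finset.mem_univ, if_true, one_mul]
  split_ifs <;> ring

theorem sum_negMulLog_two_level {k l : a} (hkl : k ≠ l) (p ε α β : ℝ) :
    ∑ x, Real.negMulLog (p * ((if x = k then α else 0) + if x = l then β else 0) + ε) =
      Real.negMulLog (p * α + ε) + Real.negMulLog (p * β + ε) +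
        (Fintype.card a - 2) * Real.negMulLog ε := by
  have h : ∀ x, Real.negMulLog (p * ((if x = k then α else 0) + if x = l then β else 0) + ε) =
      (if x = k then Real.negMulLog (p * α + ε) - Real.negMulLog ε else 0) +
      (if x = l then Real.negMulLog (p * β + ε) - Real.negMulLog ε else 0) +
        Real.negMulLog ε := by
    intro x
    by_cases h1 : x = k
    · have h2 : ¬ x = l := h1 ▸ hkl
      simp [h1, h1 ▸ h2]
    · by_cases h2 : x = l <;> simp [h1, h2, hkl.symm]
  simp only [h, Finset.sum_add_distrib, Finset.sum_ite_eq', Finset.mem_univ, if_true,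
    Finset.sum_const, Finset.card_univ, nsmul_eq_mul]
  ring

theorem sum_negMulLog_one_level (k : a) (p ε r : ℝ) :
    ∑ x, Real.negMulLog (p * (if x = k then r else 0) + ε) =
      Real.negMulLog (p * r + ε) + (Fintype.card a - 1) * Real.negMulLog ε := by
  have h : ∀ x, Real.negMulLog (p * (if x = k then r else 0) + ε) =
      (if x = k then Real.negMulLog (p * r + ε) - Real.negMulLog ε else 0) +
        Real.negMulLog ε := by
    intro x
    by_cases h1 : x = k <;> simp [h1]
  simp only [h, Finset.sum_add_distrib, Finset.sum_ite_eq', Finset.mem_univ, if_true,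
    Finset.sum_const, Finset.card_univ, nsmul_eq_mul]
  ring

variable {e : OrthonormalBasis a ℂ (EuclideanSpace ℂ a)}
  {f : OrthonormalBasis b ℂ (EuclideanSpace ℂ b)} {i : Fin 2 → a} {j : Fin 2 → b}
  {u : Fin 2 → EuclideanSpace ℂ a} {v : Fin 2 → EuclideanSpace ℂ b}

theorem schmidtMix_eq_sum (hu : ∀ l, e (i l) = u l) (hv : ∀ l, f (j l) = v l) (p ε α β : ℝ) :
    schmidtMix p ε α β u v = ∑ z : a × b, (mixWeight p ε α β i j z.2 z.1 : ℂ) •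
      proj fun t : a × b => e z.1 t.1 * f z.2 t.2 := by
  have h := ((isOrthoFamily_basis e).tensor (isOrthoFamily_basis f)).sum_two_level
    (i 0, j 0) (i 1, j 1) p ε α β
  simp only [hu, hv] at h
  exact h.symm

theorem isProductDiagonal_schmidtMix (hu : ∀ l, e (i l) = u l) (hv : ∀ l, f (j l) = v l)
    (p ε α β : ℝ) : IsProductDiagonal (schmidtMix p ε α β u v) := by
  refine ⟨e, f, fun x y => mixWeight p ε α β i j y x, ?_⟩
  rw [schmidtMix_eq_sum hu hv, ← Finset.univ_product_univ, Finset.sum_product]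
  refine Finset.sum_congr rfl fun x _ => Finset.sum_congr rfl fun y _ => ?_
  congr 1
  ext z z'
  simp [proj, Matrix.vecMulVec_apply, Matrix.kroneckerMap_apply]
  ring

theorem traceLeft_schmidtMix (hu : ∀ l, e (i l) = u l) (hv : ∀ l, f (j l) = v l)
    (p ε α β : ℝ) :
    traceLeft (schmidtMix p ε α β u v) =
      ∑ y, ((∑ x, mixWeight p ε α β i j y x : ℝ) : ℂ) • proj fun t => f y t := by
  have hn : ∀ l, ‖u l‖ = 1 := fun l => by rw [← hu, e.norm_eq_one]
  simp only [sum_mixWeight, (isOrthoFamily_basis f).sum_two_level, schmidtMix, traceLeft_add,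
    traceLeft_smul, traceLeft_one, traceLeft_proj_tensor _ _ (hn _), hv]
  rw [smul_smul]
  push_cast
  rw [mul_comm (ε : ℂ)]

theorem sum_sq_inner_eq_one (f : OrthonormalBasis b ℂ (EuclideanSpace ℂ b))
    {g : EuclideanSpace ℂ b} (hg : ‖g‖ = 1) : ∑ y, ‖(inner ℂ g (f y) : ℂ)‖ ^ 2 = 1 := by
  rw [f.sum_sq_norm_inner_left, hg, one_pow]

/-- A state that is diagonal in a product basis has no discord. -/
theorem discord_schmidtMix (hu : ∀ l, e (i l) = u l) (hv : ∀ l, f (j l) = v l)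
    {p ε α β : ℝ} (hp : 0 ≤ p) (hε : 0 ≤ ε) (hα : 0 ≤ α) (hβ : 0 ≤ β) :
    discord (schmidtMix p ε α β u v) = 0 := by
  have hinf := iInf_measuredCondEntropy (ρ := schmidtMix p ε α β u v) f
    (mixWeight_nonneg hp hε hα hβ i j) fun g hg => ⟨e, by
      simp only [sum_mul_mixWeight (sum_sq_inner_eq_one f hg),
        (isOrthoFamily_basis e).sum_two_level, schmidtMix, postState_add, postState_smul,
        postState_one hg, postState_proj_tensor, hu, hv, smul_smul]
      push_cast
      simp only [mul_comm]⟩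
  -- The conditional term is the joint Shannon entropy minus that of the marginal, which cancels
  -- `S(ρ_B) - S(ρ_AB)`.
  rw [discord, hinf, (isOrthoFamily_basis f).entropy_eq (traceLeft_schmidtMix hu hv p ε α β),
    ((isOrthoFamily_basis e).tensor (isOrthoFamily_basis f)).entropy_eq
      (schmidtMix_eq_sum hu hv p ε α β), ← Finset.univ_product_univ, Finset.sum_product_right]
  simp only [massEntropy, Finset.sum_sub_distrib]
  ring

theorem norm_sq_add_of_orthonormal (hu : Orthonormal ℂ u) (x y : ℂ) :
    ∑ l, ‖x * u 0 l + y * u 1 l‖ ^ 2 = ‖x‖ ^ 2 + ‖y‖ ^ 2 := by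
  have h := EuclideanSpace.norm_sq_eq (x • u 0 + y • u 1)
  simp only [PiLp.add_apply, PiLp.smul_apply, smul_eq_mul] at h
  rw [← h, norm_add_sq (𝕜 := ℂ), inner_smul_left, inner_smul_right, hu.2 (by decide), norm_smul,
    norm_smul, hu.1, hu.1]
  simp

theorem trace_traceLeft (ρ : Matrix (a × b) (a × b) ℂ) : (traceLeft ρ).trace = ρ.trace := by
  simp only [Matrix.trace, traceLeft, Matrix.diag_apply, Matrix.of_apply]
  rw [← Finset.univ_product_univ, Finset.sum_product_right]

theorem trace_proj_eq (w : a → ℂ) : (proj w).trace = ((∑ l, ‖w l‖ ^ 2 : ℝ) : ℂ) := by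
  simp [proj, Matrix.trace_vecMulVec, dotProduct, ← Complex.mul_conj']

variable {Ψ : a × b → ℂ} {φ : ℝ}

/-- The cross terms carry inner products of distinct left Schmidt vectors and vanish. -/
theorem IsSchmidt.traceLeft_proj (hS : IsSchmidt Ψ φ u v) :
    traceLeft (proj Ψ) = ((Real.cos φ ^ 2 : ℝ) : ℂ) • proj (v 0) +
      ((Real.sin φ ^ 2 : ℝ) : ℂ) • proj (v 1) := by
  have hu : ∀ k l, ∑ x, u k x * star (u l x) = if l = k then 1 else 0 := fun k l => by
    rw [sum_mul_star_eq_inner, orthonormal_iff_ite.mp hS.orthonormal_left]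
  ext y y'
  have h : ∀ x, Ψ (x, y) * star (Ψ (x, y')) =
      u 0 x * star (u 0 x) * ((Real.cos φ : ℂ) ^ 2 * (v 0 y * star (v 0 y'))) +
      u 0 x * star (u 1 x) * ((Real.cos φ : ℂ) * Real.sin φ * (v 0 y * star (v 1 y'))) +
      u 1 x * star (u 0 x) * ((Real.cos φ : ℂ) * Real.sin φ * (v 1 y * star (v 0 y'))) +
      u 1 x * star (u 1 x) * ((Real.sin φ : ℂ) ^ 2 * (v 1 y * star (v 1 y'))) := fun x => by
    rw [hS.decomp, hS.decomp]
    simp only [star_add, star_mul', star_ofReal]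
    ring
  simp only [traceLeft, proj, Matrix.of_apply, Matrix.vecMulVec_apply, Pi.star_apply, h,
    Finset.sum_add_distrib, ← Finset.sum_mul, hu]
  simp [Matrix.vecMulVec_apply]

theorem IsSchmidt.sum_norm_sq (hS : IsSchmidt Ψ φ u v) : ∑ z, ‖Ψ z‖ ^ 2 = 1 := by
  have h := trace_traceLeft (proj Ψ)
  have hv : ∀ l, ∑ y, ‖v l y‖ ^ 2 = 1 := fun l => by
    rw [← EuclideanSpace.norm_sq_eq, hS.orthonormal_right.1, one_pow]
  rw [hS.traceLeft_proj, Matrix.trace_add, Matrix.trace_smul, Matrix.trace_smul, trace_proj_eq,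
    trace_proj_eq, trace_proj_eq, hv, hv] at h
  rw [smul_eq_mul, smul_eq_mul, ← Complex.ofReal_mul, ← Complex.ofReal_mul, ← Complex.ofReal_add,
    mul_one, mul_one, Real.cos_sq_add_sin_sq] at h
  exact (Complex.ofReal_injective h).symm

/-- The discord of a noisy state of Schmidt rank two. -/
theorem IsSchmidt.discord_eq (hS : IsSchmidt Ψ φ u v) {p ε : ℝ} (hp : 0 ≤ p) (hε : 0 ≤ ε) :
    discord ((p : ℂ) • proj Ψ + (ε : ℂ) • (1 : Matrix (a × b) (a × b) ℂ)) =
      (Real.negMulLog (p * Real.cos φ ^ 2 + ε) + Real.negMulLog (p * Real.sin φ ^ 2 + ε)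
        - Real.negMulLog (p + ε) - Real.negMulLog ε) / Real.log 2 := by
  obtain ⟨e, i, -, hu⟩ := exists_basis_extension hS.orthonormal_left
  obtain ⟨f, j, hj, hv⟩ := exists_basis_extension hS.orthonormal_right
  have hinf := iInf_measuredCondEntropy
    (ρ := (p : ℂ) • proj Ψ + (ε : ℂ) • (1 : Matrix (a × b) (a × b) ℂ)) f
    (pureWeight_nonneg hp hε (sq_nonneg (Real.cos φ)) (sq_nonneg (Real.sin φ)) i j)
    fun g hg => by
      -- The large eigenvalue is placed at the same index `i 0` for every `g`. This alignment makes
      -- the ordered spectrum an average of fixed spectra, although the eigenbasis `e'` varies with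
      -- `g`.
      obtain ⟨e', he'⟩ := exists_spectral_proj_add (fun x => ∑ y, star (g y) * Ψ (x, y)) (i 0) p ε
      refine ⟨e', ?_⟩
      have hw : ∑ x, ‖∑ y, star (g y) * Ψ (x, y)‖ ^ 2 =
          ‖(inner ℂ g (f (j 0)) : ℂ)‖ ^ 2 * Real.cos φ ^ 2 + ‖(inner ℂ g (f (j 1)) : ℂ)‖ ^ 2 * Real.sin φ ^ 2 := by
        have h1 : ∀ x, ∑ y, star (g y) * Ψ (x, y) =
            Real.cos φ * inner ℂ g (v 0) * u 0 x + Real.sin φ * inner ℂ g (v 1) * u 1 x := by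
          intro x
          rw [← sum_star_mul_eq_inner, ← sum_star_mul_eq_inner, Finset.mul_sum, Finset.mul_sum,
            Finset.sum_mul, Finset.sum_mul, ← Finset.sum_add_distrib]
          exact Finset.sum_congr rfl fun y _ => by rw [hS.decomp]; ring
        simp only [h1, norm_sq_add_of_orthonormal hS.orthonormal_left, norm_mul, mul_pow,
          Complex.norm_real, Real.norm_eq_abs, sq_abs, hv]
        ring
      simp only [sum_mul_pureWeight (sum_sq_inner_eq_one f hg), postState_add, postState_smul,
        postState_one hg, postState_proj, he', hw]
  have htr : traceLeft ((p : ℂ) • proj Ψ + (ε : ℂ) • (1 : Matrix (a × b) (a × b) ℂ)) =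
      ∑ y, ((∑ x, pureWeight p ε (Real.cos φ ^ 2) (Real.sin φ ^ 2) i j y x : ℝ) : ℂ) • proj fun t => f y t := by
    simp only [sum_pureWeight, (isOrthoFamily_basis f).sum_two_level, traceLeft_add,
      traceLeft_smul, traceLeft_one, hS.traceLeft_proj, hv]
    rw [smul_smul (ε : ℂ), Complex.ofReal_mul, Complex.ofReal_natCast, mul_comm (ε : ℂ)]
  obtain ⟨e', he'⟩ := exists_spectral_proj_add Ψ (i 0, j 0) p ε
  rw [discord, hinf, (isOrthoFamily_basis f).entropy_eq htr,
    (isOrthoFamily_basis e').entropy_eq he', hS.sum_norm_sq, sum_negMulLog_one_level]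
  -- After the marginal entropies cancel only this double sum and the joint entropy remain. Their
  -- multiples of `η(ε)` are `|a||b| - 2` and `|a||b| - 1`, leaving a single `-η(ε)`.
  have h0 : ∑ y, ∑ x, Real.negMulLog (pureWeight p ε (Real.cos φ ^ 2) (Real.sin φ ^ 2) i j y x) =
      Real.negMulLog (p * Real.cos φ ^ 2 + ε) + Real.negMulLog (p * Real.sin φ ^ 2 + ε) +
        (Fintype.card b - 2) * Real.negMulLog ε +
        Fintype.card b * ((Fintype.card a - 1) * Real.negMulLog ε) := by
    simp only [pureWeight, sum_negMulLog_one_level, Finset.sum_add_distrib,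
      sum_negMulLog_two_level (hj.ne (show (0 : Fin 2) ≠ 1 by decide)), Finset.sum_const,
      Finset.card_univ, nsmul_eq_mul]
  simp only [massEntropy, Finset.sum_sub_distrib, h0, Fintype.card_prod]
  push_cast
  ring_nf

theorem IsSchmidt.discord_nonneg (hS : IsSchmidt Ψ φ u v) {p ε : ℝ} (hp : 0 ≤ p) (hε : 0 ≤ ε) :
    0 ≤ discord ((p : ℂ) • proj Ψ + (ε : ℂ) • (1 : Matrix (a × b) (a × b) ℂ)) := by
  rw [hS.discord_eq hp hε]
  apply div_nonneg _ (Real.log_nonneg (by norm_num))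
  have h := negMulLog_exchange_nonneg (x := p * Real.cos φ ^ 2) (y := p * Real.sin φ ^ 2)
    (by positivity) (by positivity) hε
  rwa [← mul_add, Real.cos_sq_add_sin_sq, mul_one] at h

theorem IsSchmidt.discord_le (hS : IsSchmidt Ψ φ u v) {p ε : ℝ} (hp : 0 ≤ p) (hε : 0 ≤ ε) :
    discord ((p : ℂ) • proj Ψ + (ε : ℂ) • (1 : Matrix (a × b) (a × b) ℂ)) ≤
      2 * (p * Real.sin (2 * φ)) / Real.log 2 := by
  rw [hS.discord_eq hp hε]
  exact div_le_div_of_nonneg_right (negMulLog_exchange_le_mul hp hε hS.angle_mem)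
    (Real.log_nonneg (by norm_num))

/-- The square of this Hermitian matrix is `r²` times the projector onto the span of `w k` and `w
l`, so there are two singular values equal to `r` and the rest vanish. -/
theorem IsOrthoFamily.traceNorm_offDiagonal {w : a → a → ℂ} (hw : IsOrthoFamily w) {k l : a}
    (hkl : k ≠ l) {r : ℝ} (hr : 0 ≤ r) :
    traceNorm ((r : ℂ) • (Matrix.vecMulVec (w k) (star (w l)) +
      Matrix.vecMulVec (w l) (star (w k)))) = 2 * r := by
  have h : ((r : ℂ) • (Matrix.vecMulVec (w k) (star (w l)) +
      Matrix.vecMulVec (w l) (star (w k)))).conjTranspose *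
      ((r : ℂ) • (Matrix.vecMulVec (w k) (star (w l)) +
      Matrix.vecMulVec (w l) (star (w k)))) =
      ∑ x, ((1 * ((if x = k then r ^ 2 else 0) + if x = l then r ^ 2 else 0) + 0 : ℝ) : ℂ) •
        proj (w x) := by
    rw [hw.sum_two_level, Matrix.conjTranspose_smul, Matrix.conjTranspose_add,
      Matrix.conjTranspose_vecMulVec, Matrix.conjTranspose_vecMulVec, star_star, star_star,
      Matrix.smul_mul, Matrix.mul_smul, smul_smul]
    simp only [Matrix.add_mul, Matrix.mul_add, Matrix.vecMulVec_mul_vecMulVec, hw k k, hw l l,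
      hw k l, hw l k, if_neg hkl, if_neg hkl.symm, if_true, one_smul, zero_smul, proj]
    simp [sq, ← smul_add, add_comm]
  rw [hw.traceNorm_eq h]
  have h2 : ∀ x, √(1 * ((if x = k then r ^ 2 else 0) + if x = l then r ^ 2 else 0) + 0) =
      (if x = k then r else 0) + if x = l then r else 0 := by
    intro x
    by_cases h1 : x = k
    · have h2 : ¬ x = l := h1 ▸ hkl
      simp [h1, h1 ▸ h2, Real.sqrt_sq hr]
    · by_cases h2 : x = l <;> simp [h1, h2, hkl.symm, Real.sqrt_sq hr]
  simp only [h2, Finset.sum_add_distrib, Finset.sum_ite_eq', Finset.mem_univ, if_true]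
  ring

/-- The noise and the diagonal Schmidt terms cancel, leaving the coherences with coefficient `p cos
φ sin φ`. -/
theorem IsSchmidt.traceNorm_sub (hS : IsSchmidt Ψ φ u v) {p : ℝ} (hp : 0 ≤ p) (ε : ℝ) :
    traceNorm ((p : ℂ) • proj Ψ + (ε : ℂ) • (1 : Matrix (a × b) (a × b) ℂ) -
      schmidtMix p ε (Real.cos φ ^ 2) (Real.sin φ ^ 2) u v) = p * Real.sin (2 * φ) := by
  obtain ⟨e, i, hi, hu⟩ := exists_basis_extension hS.orthonormal_left
  obtain ⟨f, j, -, hv⟩ := exists_basis_extension hS.orthonormal_right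
  have hc : 0 ≤ Real.cos φ :=
    Real.cos_nonneg_of_mem_Icc ⟨by linarith [hS.angle_mem.1, Real.pi_pos], hS.angle_mem.2⟩
  have hs : 0 ≤ Real.sin φ := Real.sin_nonneg_of_nonneg_of_le_pi hS.angle_mem.1
    (by linarith [hS.angle_mem.2, Real.pi_pos])
  have hne : (i 0, j 0) ≠ (i 1, j 1) := fun h =>
    absurd (hi (congrArg Prod.fst h)) (by decide)
  have h := ((isOrthoFamily_basis e).tensor (isOrthoFamily_basis f)).traceNorm_offDiagonal hne
    (show 0 ≤ p * (Real.cos φ * Real.sin φ) by positivity)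
  simp only [hu, hv] at h
  have hM : (p : ℂ) • proj Ψ + (ε : ℂ) • (1 : Matrix (a × b) (a × b) ℂ) -
      schmidtMix p ε (Real.cos φ ^ 2) (Real.sin φ ^ 2) u v =
      ((p * (Real.cos φ * Real.sin φ) : ℝ) : ℂ) •
        (Matrix.vecMulVec (fun z : a × b => u 0 z.1 * v 0 z.2)
          (star fun z : a × b => u 1 z.1 * v 1 z.2) +
        Matrix.vecMulVec (fun z : a × b => u 1 z.1 * v 1 z.2)
          (star fun z : a × b => u 0 z.1 * v 0 z.2)) := by
    ext ⟨x, y⟩ ⟨x', y'⟩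
    simp only [schmidtMix, proj, Matrix.sub_apply, Matrix.add_apply, Matrix.smul_apply,
      Matrix.vecMulVec_apply, Pi.star_apply, smul_eq_mul, hS.decomp, star_add, star_mul',
      star_ofReal]
    push_cast
    ring
  rw [hM, h, Real.sin_two_mul]
  ring

end Schmidt

/-! ### Existence of the Schmidt decomposition -/

section Existence

/-- Singular value decomposition of a real `2 × 2` matrix of unit Frobenius norm. -/
theorem exists_svd_two {A B C D : ℝ} (h : A ^ 2 + B ^ 2 + C ^ 2 + D ^ 2 = 1) :
    ∃ φ ∈ Set.Icc 0 (Real.pi / 2), ∃ α β σ : ℝ, σ ^ 2 = 1 ∧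
      A = Real.cos φ * (Real.cos α * Real.cos β) +
        Real.sin φ * (-(σ * Real.sin α) * -Real.sin β) ∧
      B = Real.cos φ * (Real.cos α * Real.sin β) + Real.sin φ * (-(σ * Real.sin α) * Real.cos β) ∧
      C = Real.cos φ * (Real.sin α * Real.cos β) + Real.sin φ * (σ * Real.cos α * -Real.sin β) ∧
      D = Real.cos φ * (Real.sin α * Real.sin β) + Real.sin φ * (σ * Real.cos α * Real.cos β) := by
  -- `z` and `w` encode the rotation and reflection parts of the matrix. Half the sum and half the
  -- difference of their moduli are the signed singular values `x` and `y`, and their arguments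
  -- determine `α - β` and `α + β`.
  obtain ⟨z, hz⟩ : ∃ z : ℂ, z = ⟨A + D, C - B⟩ := ⟨_, rfl⟩
  obtain ⟨w, hw⟩ : ∃ w : ℂ, w = ⟨A - D, B + C⟩ := ⟨_, rfl⟩
  obtain ⟨α, β, h1, h2⟩ : ∃ α β : ℝ, α - β = z.arg ∧ α + β = w.arg :=
    ⟨(z.arg + w.arg) / 2, (w.arg - z.arg) / 2, by ring, by ring⟩
  have e1 : ‖z‖ * Real.cos (α - β) = A + D := by rw [h1, Complex.norm_mul_cos_arg, hz]
  have e2 : ‖z‖ * Real.sin (α - β) = C - B := by rw [h1, Complex.norm_mul_sin_arg, hz]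
  have e3 : ‖w‖ * Real.cos (α + β) = A - D := by rw [h2, Complex.norm_mul_cos_arg, hw]
  have e4 : ‖w‖ * Real.sin (α + β) = B + C := by rw [h2, Complex.norm_mul_sin_arg, hw]
  have n1 : ‖z‖ ^ 2 = (A + D) ^ 2 + (C - B) ^ 2 := by
    rw [Complex.sq_norm, Complex.normSq_apply, hz]
    ring
  have n2 : ‖w‖ ^ 2 = (A - D) ^ 2 + (B + C) ^ 2 := by
    rw [Complex.sq_norm, Complex.normSq_apply, hw]
    ring
  rw [Real.cos_sub] at e1
  rw [Real.sin_sub] at e2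
  rw [Real.cos_add] at e3
  rw [Real.sin_add] at e4
  set x := (‖z‖ + ‖w‖) / 2 with hx
  set y := (‖z‖ - ‖w‖) / 2 with hy
  have hxy : x ^ 2 + y ^ 2 = 1 := by
    rw [hx, hy]
    linear_combination (n1 + n2) / 2 + h
  have hx0 : 0 ≤ x := by positivity
  have hx1 : x ≤ 1 := by nlinarith [sq_nonneg y]
  -- The sign of the determinant is moved into the second left singular vector, so that both Schmidt
  -- coefficients are nonnegative and `φ` lies in the first quadrant.
  obtain ⟨σ, hσ, hσy⟩ : ∃ σ : ℝ, σ ^ 2 = 1 ∧ y = σ * |y| := by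
    rcases le_total 0 y with hy0 | hy0
    · exact ⟨1, by norm_num, by rw [abs_of_nonneg hy0, one_mul]⟩
    · exact ⟨-1, by norm_num, by rw [abs_of_nonpos hy0]; ring⟩
  have hc : Real.cos (Real.arccos x) = x := Real.cos_arccos (by linarith) hx1
  have hs : Real.sin (Real.arccos x) = |y| := by
    rw [Real.sin_arccos, show 1 - x ^ 2 = y ^ 2 by linarith, Real.sqrt_sq_eq_abs]
  refine ⟨Real.arccos x, ⟨Real.arccos_nonneg x, Real.arccos_le_pi_div_two.mpr hx0⟩, α, β, σ, hσ, ?_⟩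
  rw [hc, hs]
  refine ⟨?_, ?_, ?_, ?_⟩
  · linear_combination -(e1 + e3) / 2 + Real.sin α * Real.sin β * hσy
  · linear_combination -(e4 - e2) / 2 - Real.sin α * Real.cos β * hσy
  · linear_combination -(e4 + e2) / 2 - Real.cos α * Real.sin β * hσy
  · linear_combination -(e1 - e3) / 2 + Real.cos α * Real.cos β * hσy

variable {a b : Type*} [Fintype a] [DecidableEq a] [Fintype b] [DecidableEq b]

/-- The vector with component `x` along the marked basis state `i₀` and component `y` along the
uniform superposition of all others. -/
noncomputable def markedVec (i₀ : a) (x y : ℝ) : EuclideanSpace ℂ a :=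
  WithLp.toLp 2 fun i => if i = i₀ then (x : ℂ) else ((y / √(Fintype.card a - 1) : ℝ) : ℂ)

theorem inner_markedVec (ha : 2 ≤ Fintype.card a) (i₀ : a) (x y x' y' : ℝ) :
    inner ℂ (markedVec i₀ x y) (markedVec i₀ x' y') = ((x * x' + y * y' : ℝ) : ℂ) := by
  have hr : (0 : ℝ) < Fintype.card a - 1 := by
    have : (2 : ℝ) ≤ Fintype.card a := by exact_mod_cast ha
    linarith
  have h : ∀ i, star (markedVec i₀ x y i) * markedVec i₀ x' y' i =
      ((if i = i₀ then x * x' - y * y' / (Fintype.card a - 1) else 0 : ℝ) : ℂ) +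
        ((y * y' / (Fintype.card a - 1) : ℝ) : ℂ) := by
    intro i
    have hk : y / √(Fintype.card a - 1) * (y' / √(Fintype.card a - 1)) =
        y * y' / (Fintype.card a - 1 : ℝ) := by
      rw [div_mul_div_comm, Real.mul_self_sqrt hr.le]
    by_cases hi : i = i₀
    · simp only [markedVec, hi, if_true, star_ofReal]
      push_cast
      ring
    · simp only [markedVec, hi, if_false, star_ofReal]
      rw [← Complex.ofReal_mul, hk]
      simp
  rw [← sum_star_mul_eq_inner]
  simp only [h, ← Complex.ofReal_add, ← Complex.ofReal_sum, Finset.sum_add_distrib,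
    Finset.sum_ite_eq', Finset.mem_univ, if_true, Finset.sum_const, Finset.card_univ, nsmul_eq_mul]
  congr 1
  field_simp
  ring

theorem orthonormal_markedVec (ha : 2 ≤ Fintype.card a) (i₀ : a) (α : ℝ) {σ : ℝ}
    (hσ : σ ^ 2 = 1) :
    Orthonormal ℂ ![markedVec i₀ (Real.cos α) (Real.sin α),
      markedVec i₀ (-(σ * Real.sin α)) (σ * Real.cos α)] := by
  have h := Real.cos_sq_add_sin_sq α
  rw [orthonormal_iff_ite]
  intro k l
  fin_cases k <;> fin_cases l <;>
    simp only [Fin.zero_eta, Fin.mk_one, Matrix.cons_val_zero, Matrix.cons_val_one,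
      inner_markedVec ha, if_true, zero_ne_one, one_ne_zero, if_false]
  · rw [← Complex.ofReal_one, ← h]
    congr 1
    ring
  · rw [← Complex.ofReal_zero]
    congr 1
    ring
  · rw [← Complex.ofReal_zero]
    congr 1
    ring
  · rw [← Complex.ofReal_one]
    congr 1
    linear_combination σ ^ 2 * h + hσ

/-- A unit vector that is constant away from one product basis state has Schmidt rank two. -/
theorem exists_isSchmidt (ha : 2 ≤ Fintype.card a) (hb : 2 ≤ Fintype.card b) (z₀ : a × b) (θ : ℝ) :
    ∃ φ u v, IsSchmidt (fun z : a × b => if z = z₀ then (Real.cos θ : ℂ) else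
      ((Real.sin θ / √(Fintype.card a * Fintype.card b - 1) : ℝ) : ℂ)) φ u v := by
  obtain ⟨i₀, j₀⟩ := z₀
  have ha' : (2 : ℝ) ≤ Fintype.card a := by exact_mod_cast ha
  have hb' : (2 : ℝ) ≤ Fintype.card b := by exact_mod_cast hb
  generalize hm : (Fintype.card a : ℝ) = m at *
  generalize hk : (Fintype.card b : ℝ) = k at *
  have hmk : 0 < m * k - 1 := by nlinarith
  have hsa : √(m - 1) ≠ 0 := (Real.sqrt_pos.mpr (by linarith)).ne'
  have hsb : √(k - 1) ≠ 0 := (Real.sqrt_pos.mpr (by linarith)).ne'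
  set t := Real.sin θ / √(m * k - 1) with ht
  have ht2 : t ^ 2 * (m * k - 1) = Real.sin θ ^ 2 := by
    rw [ht, div_pow, Real.sq_sqrt hmk.le, div_mul_cancel₀ _ hmk.ne']
  -- These are the coefficients in the bases formed by the marked state and the normalised
  -- superposition of the rest; the square roots are the norms of the all-ones vectors on the
  -- unmarked states. The Frobenius norm is one because `(k-1) + (m-1) + (m-1)(k-1) = mk - 1`.
  obtain ⟨φ, hφ, α, β, σ, hσ, hA, hB, hC, hD⟩ := exists_svd_two
    (A := Real.cos θ) (B := t * √(k - 1)) (C := t * √(m - 1)) (D := t * (√(m - 1) * √(k - 1))) (by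
      simp only [mul_pow]
      rw [Real.sq_sqrt (by linarith), Real.sq_sqrt (by linarith)]
      linear_combination ht2 + Real.cos_sq_add_sin_sq θ)
  refine ⟨φ, _, _, hφ, orthonormal_markedVec ha i₀ α hσ,
    orthonormal_markedVec hb j₀ β (one_pow 2), fun i j => ?_⟩
  simp only [Matrix.cons_val_zero, Matrix.cons_val_one, markedVec, Prod.mk.injEq, one_mul, hm, hk]
  by_cases hi : i = i₀ <;> by_cases hj : j = j₀ <;>
    simp only [hi, hj, and_self, and_true, and_false, if_true, if_false] <;>
    simp only [← Complex.ofReal_mul, ← Complex.ofReal_add] <;> congr 1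
  · field_simp
    linarith
  · field_simp
    linarith
  · field_simp
    linarith

end Existence

/-! ### Specialisation to the Grover register and scaling in the number of qubits -/

section Grover

variable {n : ℕ} {S : Finset (Fin n)}

theorem card_inside_mul_card_outside (S : Finset (Fin n)) :
    Fintype.card (Inside S) * Fintype.card (Outside S) = 2 ^ n := by
  rw [← Fintype.card_prod, ← Fintype.card_congr (bipartition S)]
  simp

theorem two_le_card_inside (hS : S.Nonempty) : 2 ≤ Fintype.card (Inside S) := by
  rw [Fintype.card_fun, Fintype.card_bool]
  obtain ⟨x, hx⟩ := hS
  have : 0 < Fintype.card {i : Fin n // i ∈ S} := Fintype.card_pos_iff.mpr ⟨⟨x, hx⟩⟩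
  exact Nat.le_self_pow this.ne' 2

theorem two_le_card_outside (hS : Sᶜ.Nonempty) : 2 ≤ Fintype.card (Outside S) := by
  rw [Fintype.card_fun, Fintype.card_bool]
  obtain ⟨x, hx⟩ := hS
  have : 0 < Fintype.card {i : Fin n // ¬ i ∈ S} :=
    Fintype.card_pos_iff.mpr ⟨⟨x, Finset.mem_compl.mp hx⟩⟩
  exact Nat.le_self_pow this.ne' 2

theorem two_le_of_bipartition (hS : S.Nonempty) (hS' : Sᶜ.Nonempty) : 2 ≤ n := by
  obtain ⟨x, hx⟩ := hS
  obtain ⟨y, hy⟩ := hS'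
  have hne : x ≠ y := fun h => Finset.mem_compl.mp hy (h ▸ hx)
  have := Fin.val_ne_of_ne hne
  omega

theorem exists_isSchmidt_groverVecAcross (x₀ : Fin n → Bool) (hS : S.Nonempty)
    (hS' : Sᶜ.Nonempty) (θ : ℝ) : ∃ φ u v, IsSchmidt (groverVecAcross S x₀ θ) φ u v := by
  have h := exists_isSchmidt (two_le_card_inside hS) (two_le_card_outside hS')
    (bipartition S x₀) θ
  have hc : (Fintype.card (Inside S) : ℝ) * Fintype.card (Outside S) = 2 ^ n := by
    exact_mod_cast card_inside_mul_card_outside S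
  rw [hc] at h
  convert h using 7 with φ u v
  ext z
  simp only [groverVecAcross, groverVec, Equiv.symm_apply_eq]

theorem groverStateAcross_eq (x₀ : Fin n → Bool) (p θ : ℝ) :
    groverStateAcross S x₀ p θ = (p : ℂ) • proj (groverVecAcross S x₀ θ) +
      (((1 - p) / 2 ^ n : ℝ) : ℂ) • 1 := by
  ext z z'
  simp [groverStateAcross, groverState, groverVecAcross, proj, Matrix.vecMulVec_apply,
    Matrix.one_apply]

theorem sigmaState_eq (p φ : ℝ) (u : Fin 2 → EuclideanSpace ℂ (Inside S))
    (v : Fin 2 → EuclideanSpace ℂ (Outside S)) :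
    sigmaState S p φ u v =
      schmidtMix p ((1 - p) / 2 ^ n) (Real.cos φ ^ 2) (Real.sin φ ^ 2) u v := rfl

theorem posSemidef_ofReal_smul {ι : Type*} {M : Matrix ι ι ℂ} (hM : M.PosSemidef) {r : ℝ}
    (hr : 0 ≤ r) : ((r : ℂ) • M).PosSemidef :=
  hM.smul (Complex.zero_le_real.mpr hr)

theorem posSemidef_proj {ι : Type*} [Finite ι] (w : ι → ℂ) : (proj w).PosSemidef :=
  Matrix.posSemidef_vecMulVec_self_star w

/-- Depolarising a density matrix. -/
theorem isDensity_depolarised {Q : Matrix (Inside S × Outside S) (Inside S × Outside S) ℂ}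
    (hQ : IsDensity Q) {p : ℝ} (hp : 0 ≤ p) (hp1 : p ≤ 1) :
    IsDensity ((p : ℂ) • Q + (((1 - p) / 2 ^ n : ℝ) : ℂ) • 1) := by
  refine ⟨(posSemidef_ofReal_smul hQ.1 hp).add (posSemidef_ofReal_smul Matrix.PosSemidef.one
    (div_nonneg (by linarith) (by positivity))), ?_⟩
  rw [Matrix.trace_add, Matrix.trace_smul, Matrix.trace_smul, hQ.2, Matrix.trace_one,
    Fintype.card_prod, card_inside_mul_card_outside]
  push_cast
  rw [smul_eq_mul, smul_eq_mul, div_mul_cancel₀ _ (by positivity)]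
  ring

theorem IsSchmidt.isDensity_groverStateAcross {x₀ : Fin n → Bool} {p θ φ : ℝ}
    {u : Fin 2 → EuclideanSpace ℂ (Inside S)} {v : Fin 2 → EuclideanSpace ℂ (Outside S)}
    (h : IsSchmidt (groverVecAcross S x₀ θ) φ u v) (hp : 0 ≤ p) (hp1 : p ≤ 1) :
    IsDensity (groverStateAcross S x₀ p θ) := by
  rw [groverStateAcross_eq]
  exact isDensity_depolarised ⟨posSemidef_proj _, by rw [trace_proj_eq, h.sum_norm_sq]; simp⟩ hp hp1

theorem isDensity_sigmaState {p : ℝ} (φ : ℝ) {u : Fin 2 → EuclideanSpace ℂ (Inside S)}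
    {v : Fin 2 → EuclideanSpace ℂ (Outside S)} (hu : Orthonormal ℂ u) (hv : Orthonormal ℂ v)
    (hp : 0 ≤ p) (hp1 : p ≤ 1) : IsDensity (sigmaState S p φ u v) := by
  refine isDensity_depolarised ⟨(posSemidef_ofReal_smul (posSemidef_proj _) (sq_nonneg _)).add
    (posSemidef_ofReal_smul (posSemidef_proj _) (sq_nonneg _)), ?_⟩ hp hp1
  have h1 : ∀ l, (proj fun z : Inside S × Outside S => u l z.1 * v l z.2).trace = 1 := fun l => by
    rw [← trace_traceLeft, traceLeft_proj_tensor _ _ (hu.1 l), trace_proj_eq,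
      ← EuclideanSpace.norm_sq_eq, hv.1]
    simp
  rw [Matrix.trace_add, Matrix.trace_smul, Matrix.trace_smul, h1, h1, smul_eq_mul, smul_eq_mul,
    mul_one, mul_one, ← Complex.ofReal_add, Real.cos_sq_add_sin_sq, Complex.ofReal_one]

theorem sin_two_mul_mem {φ : ℝ} (hφ : φ ∈ Set.Icc 0 (Real.pi / 2)) :
    0 ≤ Real.sin (2 * φ) ∧ Real.sin (2 * φ) ≤ 1 :=
  ⟨Real.sin_nonneg_of_nonneg_of_le_pi (by linarith [hφ.1]) (by linarith [hφ.2]),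
    Real.sin_le_one _⟩

theorem IsSchmidt.discord_grover_nonneg {x₀ : Fin n → Bool} {p θ φ : ℝ}
    {u : Fin 2 → EuclideanSpace ℂ (Inside S)} {v : Fin 2 → EuclideanSpace ℂ (Outside S)}
    (h : IsSchmidt (groverVecAcross S x₀ θ) φ u v) (hp : 0 ≤ p) (hp1 : p ≤ 1) :
    0 ≤ discord (groverStateAcross S x₀ p θ) := by
  rw [groverStateAcross_eq]
  exact h.discord_nonneg hp (div_nonneg (by linarith) (by positivity))

theorem IsSchmidt.discord_grover_le {x₀ : Fin n → Bool} {p θ φ : ℝ}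
    {u : Fin 2 → EuclideanSpace ℂ (Inside S)} {v : Fin 2 → EuclideanSpace ℂ (Outside S)}
    (h : IsSchmidt (groverVecAcross S x₀ θ) φ u v) (hp : 0 ≤ p) (hp1 : p ≤ 1) (hn : 2 ≤ n) :
    discord (groverStateAcross S x₀ p θ) ≤
      8 * (p * Real.sin (2 * φ)) * ((n : ℝ) - 1) + 4 * GroverDiscord.h (p * Real.sin (2 * φ)) := by
  obtain ⟨h0, h1⟩ := sin_two_mul_mem h.angle_mem
  have hd0 : 0 ≤ p * Real.sin (2 * φ) := mul_nonneg hp h0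
  have hd1 : p * Real.sin (2 * φ) ≤ 1 := mul_le_one₀ hp1 h0 h1
  have hD := h.discord_le hp (show 0 ≤ (1 - p) / 2 ^ n from
    div_nonneg (by linarith) (by positivity))
  rw [groverStateAcross_eq]
  refine hD.trans ?_
  have hh := h_nonneg hd0 hd1
  have hn' : (2 : ℝ) ≤ n := by exact_mod_cast hn
  have hl2 := Real.log_two_gt_d9
  rw [div_le_iff₀ (by linarith)]
  generalize p * Real.sin (2 * φ) = d at *
  -- There is ample slack: `n - 1 ≥ 1` and `h d ≥ 0` leave `8d` available, while the discord is at
  -- most `2d / log 2`.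
  have e1 : 8 * d ≤ 8 * d * ((n : ℝ) - 1) + 4 * GroverDiscord.h d := by nlinarith
  nlinarith

/-- The scaling of the discord bound. -/
theorem discord_bound_le {ε K : ℝ} (hK : 0 < K) (hn : 1 ≤ n) {d : ℝ} (hd0 : 0 ≤ d) (hd1 : d ≤ 1)
    (hd : d ≤ K * (2 : ℝ) ^ (-(n : ℝ) * (1 / 2 - ε))) :
    8 * d * ((n : ℝ) - 1) + 4 * h d ≤
      (8 * K + 8 + 4 * K * |1 / 2 - ε|) * (n * (2 : ℝ) ^ (-(n : ℝ) * (1 / 2 - ε))) := by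
  have hn' : (1 : ℝ) ≤ n := by exact_mod_cast hn
  have ht : (0 : ℝ) < (2 : ℝ) ^ (-(n : ℝ) * (1 / 2 - ε)) := by positivity
  have hlog : Real.log ((2 : ℝ) ^ (-(n : ℝ) * (1 / 2 - ε))) =
      -(n : ℝ) * (1 / 2 - ε) * Real.log 2 := Real.log_rpow (by norm_num) _
  -- The tangent point is the scaling factor `t` itself: its logarithm is linear in `n`, which
  -- produces the single factor `n` in the bound. The three summands of the constant bound
  -- `8d(n-1)`, `4t / log 2` and `4dn(1/2 - ε)` respectively; the absolute value allows `ε > 1/2`.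
  have hh := h_le hd0 hd1 ht
  rw [hlog] at hh
  generalize (2 : ℝ) ^ (-(n : ℝ) * (1 / 2 - ε)) = t at *
  generalize (1 / 2 - ε) = r at *
  have hl2 := Real.log_two_gt_d9
  have hl2' : Real.log 2 ≠ 0 := by linarith
  have e0 : (t - d * (-(n : ℝ) * r * Real.log 2)) / Real.log 2 = t / Real.log 2 + d * n * r := by
    field_simp
    ring
  have e1 : t / Real.log 2 ≤ 2 * t := by
    rw [div_le_iff₀ (by linarith)]
    nlinarith
  have e2 : d * n * r ≤ K * t * n * |r| := by
    calc d * n * r ≤ d * n * |r| := by gcongr; exact le_abs_self r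
      _ ≤ K * t * n * |r| := by gcongr
  have e3 : t ≤ n * t := by nlinarith
  have e4 : d * ((n : ℝ) - 1) ≤ K * t * n := by
    calc d * ((n : ℝ) - 1) ≤ d * n := by gcongr; linarith
      _ ≤ K * t * n := by gcongr
  rw [e0] at hh
  nlinarith

end Grover

end GroverDiscord

/-! ### Assembly of the main theorem -/

theorem mainTheorem3 :
    -- a Schmidt angle exists for every state of the algorithm and every bipartition
    (∀ (n : ℕ) (x₀ : Fin n → Bool) (S : Finset (Fin n)), S.Nonempty → Sᶜ.Nonempty → ∀ θ : ℝ,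
      ∃ φ u v, GroverDiscord.IsSchmidt (GroverDiscord.groverVecAcross S x₀ θ) φ u v) ∧
    -- the nearby zero-discord state, and the discord bound
    (∀ (n : ℕ) (x₀ : Fin n → Bool) (S : Finset (Fin n)), S.Nonempty → Sᶜ.Nonempty →
      ∀ p θ φ : ℝ, 0 < p → p ≤ 1 →
      ∀ (u : Fin 2 → EuclideanSpace ℂ (GroverDiscord.Inside S))
        (v : Fin 2 → EuclideanSpace ℂ (GroverDiscord.Outside S)),
      GroverDiscord.IsSchmidt (GroverDiscord.groverVecAcross S x₀ θ) φ u v →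
      ∀ d : ℝ, d = p * Real.sin (2 * φ) →
        GroverDiscord.IsDensity (GroverDiscord.groverStateAcross S x₀ p θ) ∧
        GroverDiscord.IsDensity (GroverDiscord.sigmaState S p φ u v) ∧
        GroverDiscord.IsProductDiagonal (GroverDiscord.sigmaState S p φ u v) ∧
        GroverDiscord.discord (GroverDiscord.sigmaState S p φ u v) = 0 ∧
        GroverDiscord.traceNorm (GroverDiscord.groverStateAcross S x₀ p θ -
          GroverDiscord.sigmaState S p φ u v) = d ∧
        0 ≤ GroverDiscord.discord (GroverDiscord.groverStateAcross S x₀ p θ) ∧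
        GroverDiscord.discord (GroverDiscord.groverStateAcross S x₀ p θ) ≤
          8 * d * ((n : ℝ) - 1) + 4 * GroverDiscord.h d) ∧
    -- scaling of the bound and of the discord, uniformly in target, step and bipartition
    (∀ ε : ℝ, 0 < ε → ∀ K : ℝ, 0 < K → ∃ C : ℝ, 0 < C ∧
      ∀ (n : ℕ), 1 ≤ n → ∀ p : ℝ, 0 < p → p ≤ 1 →
        p ≤ K * (2 : ℝ) ^ (-(n : ℝ) * (1 / 2 - ε)) →
        (∀ φ ∈ Set.Icc 0 (Real.pi / 2), ∀ d : ℝ, d = p * Real.sin (2 * φ) →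
          8 * d * ((n : ℝ) - 1) + 4 * GroverDiscord.h d ≤
            C * (n * (2 : ℝ) ^ (-(n : ℝ) * (1 / 2 - ε)))) ∧
        (∀ (x₀ : Fin n → Bool) (S : Finset (Fin n)), S.Nonempty → Sᶜ.Nonempty → ∀ θ : ℝ,
          |GroverDiscord.discord (GroverDiscord.groverStateAcross S x₀ p θ)| ≤
            C * (n * (2 : ℝ) ^ (-(n : ℝ) * (1 / 2 - ε))))) ∧
    -- the discord is vanishingly small, uniformly in target, step and bipartition
    (∀ ε : ℝ, 0 < ε → ε < 1 / 2 → ∀ K : ℝ, 0 < K → ∀ δ : ℝ, 0 < δ → ∃ N : ℕ,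
      ∀ n : ℕ, N ≤ n → ∀ p : ℝ, 0 < p → p ≤ 1 →
        p ≤ K * (2 : ℝ) ^ (-(n : ℝ) * (1 / 2 - ε)) →
        ∀ (x₀ : Fin n → Bool) (S : Finset (Fin n)), S.Nonempty → Sᶜ.Nonempty → ∀ θ : ℝ,
          |GroverDiscord.discord (GroverDiscord.groverStateAcross S x₀ p θ)| ≤ δ) := by

  open GroverDiscord in
  have scaling : ∀ ε : ℝ, 0 < ε → ∀ K : ℝ, 0 < K → ∃ C : ℝ, 0 < C ∧
      ∀ (n : ℕ), 1 ≤ n → ∀ p : ℝ, 0 < p → p ≤ 1 →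
        p ≤ K * (2 : ℝ) ^ (-(n : ℝ) * (1 / 2 - ε)) →
        (∀ φ ∈ Set.Icc 0 (Real.pi / 2), ∀ d : ℝ, d = p * Real.sin (2 * φ) →
          8 * d * ((n : ℝ) - 1) + 4 * h d ≤ C * (n * (2 : ℝ) ^ (-(n : ℝ) * (1 / 2 - ε)))) ∧
        (∀ (x₀ : Fin n → Bool) (S : Finset (Fin n)), S.Nonempty → Sᶜ.Nonempty → ∀ θ : ℝ,
          |discord (groverStateAcross S x₀ p θ)| ≤
            C * (n * (2 : ℝ) ^ (-(n : ℝ) * (1 / 2 - ε)))) := by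
    intro ε _ K hK
    refine ⟨8 * K + 8 + 4 * K * |1 / 2 - ε|, by positivity, fun n hn p hp hp1 hpK => ?_⟩
    have hbound : ∀ φ ∈ Set.Icc 0 (Real.pi / 2), ∀ d : ℝ, d = p * Real.sin (2 * φ) →
        8 * d * ((n : ℝ) - 1) + 4 * h d ≤ (8 * K + 8 + 4 * K * |1 / 2 - ε|) *
          (n * (2 : ℝ) ^ (-(n : ℝ) * (1 / 2 - ε))) := by
      rintro φ hφ d rfl
      obtain ⟨h0, h1⟩ := sin_two_mul_mem hφ
      exact discord_bound_le hK hn (mul_nonneg hp.le h0) (mul_le_one₀ hp1 h0 h1)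
        ((mul_le_of_le_one_right hp.le h1).trans hpK)
    refine ⟨hbound, fun x₀ S hS hS' θ => ?_⟩
    obtain ⟨φ, u, v, hSch⟩ := exists_isSchmidt_groverVecAcross x₀ hS hS' θ
    rw [abs_of_nonneg (hSch.discord_grover_nonneg hp.le hp1)]
    exact (hSch.discord_grover_le hp.le hp1 (two_le_of_bipartition hS hS')).trans
      (hbound φ hSch.angle_mem _ rfl)
  refine ⟨fun n x₀ S hS hS' θ => GroverDiscord.exists_isSchmidt_groverVecAcross x₀ hS hS' θ,
    ?_, scaling, ?_⟩
  · rintro n x₀ S hS hS' p θ φ hp hp1 u v hSch d rfl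
    obtain ⟨e, i, -, hu⟩ := GroverDiscord.exists_basis_extension hSch.orthonormal_left
    obtain ⟨f, j, -, hv⟩ := GroverDiscord.exists_basis_extension hSch.orthonormal_right
    have hε : 0 ≤ (1 - p) / 2 ^ n := div_nonneg (by linarith) (by positivity)
    refine ⟨hSch.isDensity_groverStateAcross hp.le hp1, GroverDiscord.isDensity_sigmaState φ
      hSch.orthonormal_left hSch.orthonormal_right hp.le hp1, ?_, ?_, ?_,
      hSch.discord_grover_nonneg hp.le hp1,
      hSch.discord_grover_le hp.le hp1 (GroverDiscord.two_le_of_bipartition hS hS')⟩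
    · exact GroverDiscord.isProductDiagonal_schmidtMix hu hv _ _ _ _
    · exact GroverDiscord.discord_schmidtMix hu hv hp.le hε (sq_nonneg _) (sq_nonneg _)
    · rw [GroverDiscord.groverStateAcross_eq, GroverDiscord.sigmaState_eq]
      exact hSch.traceNorm_sub hp.le _
  · intro ε hε hε2 K hK δ hδ
    obtain ⟨C, hC, h⟩ := scaling ε hε K hK
    have hr : (2 : ℝ) ^ (-(1 / 2 - ε)) < 1 :=
      Real.rpow_lt_one_of_one_lt_of_neg (by norm_num) (by linarith)
    -- The scaling bound is `C n rⁿ` with `r = 2^{-(1/2-ε)} < 1`, so the geometric decay beats the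
    -- factor `n`.
    have hlim := (tendsto_self_mul_const_pow_of_lt_one (by positivity) hr).const_mul C
    rw [mul_zero] at hlim
    obtain ⟨N, hN⟩ := Filter.eventually_atTop.mp (hlim.eventually (gt_mem_nhds hδ))
    -- The shift by one supplies the condition `1 ≤ n` of the scaling bound.
    refine ⟨N + 1, fun n hn p hp hp1 hpK x₀ S hS hS' θ => ?_⟩
    refine ((h n (by omega) p hp hp1 hpK).2 x₀ S hS hS' θ).trans ?_
    have := hN n (by omega)
    rw [← Real.rpow_natCast, ← Real.rpow_mul (by norm_num),
      show -(1 / 2 - ε) * (n : ℝ) = -(n : ℝ) * (1 / 2 - ε) by ring] at this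
    exact this.le
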